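/- All manifolds and tensor fields are smooth; manifolds are non-empty, Hausdorff and second countable. The exterior derivative is normalized by $d\eta(X,Y)=X(\eta(Y))-Y(\eta(X))-\eta([X,Y])$. **Definitions.** An *almost contact metric structure* $(\phi,\xi,\eta,g)$ on $M$ consists of a field of endomorphisms $\phi$ of $TM$, a vector field $\xi$, a $1$-form $\eta$ and a Riemannian metric $g$ with $\phi^2=-I+\eta\otimes\xi$, $\eta(\xi)=1$ and $g(\phi X,\phi Y)=g(X,Y)-\eta(X)\eta(Y)$; its fundamental $2$-form is $\Omega(X,Y)=g(X,\phi Y)$. It is *quasi-Sasakian* if $d\Omega=0$ and it is normal, i.e. $$[\phi X,\phi Y]-\phi[\phi X,Y]-\phi[X,\phi Y]+\phi^2[X,Y]+d\eta(X,Y)\,\xi=0$$ for all vector fields $X,Y$. The *rank* (Cartan class) of a $1$-form $\eta$ at $x$ is the codimension in $T_xM$ of its characteristic space $\mathcal C(\eta)_x=\{X\in T_xM : i_X\eta=0,\ i_Xd\eta=0\}$; $\eta$ has rank $k$ if this equals $k$ at every point. A *$3$-quasi-Sasakian manifold* $(M,\phi_\alpha,\xi_\alpha,\eta_\alpha,g)_{\alpha\in\{1,2,3\}}$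 is a manifold with three quasi-Sasakian structures with the same metric $g$ such that, for every even permutation $(\alpha,\beta,\gamma)$ of $\{1,2,3\}$, $$\phi_\gamma=\phi_\alpha\phi_\beta-\eta_\beta\otimes\xi_\alpha=-\phi_\beta\phi_\alpha+\eta_\alpha\otimes\xi_\beta,\quad \xi_\gamma=\phi_\alpha\xi_\beta=-\phi_\beta\xi_\alpha,\quad \eta_\gamma=\eta_\alpha\circ\phi_\beta=-\eta_\beta\circ\phi_\alpha.$$ It has *rank* $k$ if $\eta_1,\eta_2,\eta_3$ all have rank $k$. An *almost cosymplectic structure* on a manifold of dimension $2n+1$ is a pair $(\eta,\Omega)$ of a $1$-form and a $2$-form such that $\eta\wedge\Omega^n$ vanishes nowhere. Pairs $(\eta_i,\Omega_i)$, $i=1,2,3$, generate an *almost cosymplectic sphere* if each of them and each pair $(\eta_\lambda,\Omega_\lambda)=(\sum_i\lambda_i\eta_i,\sum_i\lambda_i\Omega_i)$ with $\lambda\in\mathbb S^2$ is an almost cosymplectic structure; the sphere is *quasi-contact of rank* $k>0$ if moreover $d\Omega_\lambda=0$ and $\eta_\lambda$ has rank $k$ for every $\lambda\in\mathbb S^2$.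 **Theorem.** Let $(M,\phi_\alpha,\xi_\alpha,\eta_\alpha,g)_{\alpha\in\{1,2,3\}}$ be a $3$-quasi-Sasakian manifold of rank $4l+3$, $l\ge 0$, with fundamental $2$-forms $\Omega_\alpha=g(\cdot,\phi_\alpha\cdot)$. For $\lambda\in\mathbb S^2$ put $$\phi_\lambda=\sum_\alpha\lambda_\alpha\phi_\alpha,\qquad \xi_\lambda=\sum_\alpha\lambda_\alpha\xi_\alpha,\qquad \eta_\lambda=\sum_\alpha\lambda_\alpha\eta_\alpha.$$ Then for every $\lambda\in\mathbb S^2$ the structure $(\phi_\lambda,\xi_\lambda,\eta_\lambda,g)$ is quasi-Sasakian, $\eta_\lambda$ has rank $4l+3$, and at every point the characteristic space $\mathcal C(\eta_\lambda)$ equals $\mathcal E=\{X : i_X\eta_\alpha=0,\ i_Xd\eta_\alpha=0 \text{ for } \alpha=1,2,3\}$. Moreover $(\eta_1,\Omega_1),(\eta_2,\Omega_2),(\eta_3,\Omega_3)$ generate an almost cosymplectic sphere, and this sphere is quasi-contact of rank $4l+3$. -/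

import Mathlib

open Set Bundle Manifold VectorField
open scoped Manifold ContDiff Topology

noncomputable section

namespace QuasiContact

/-! ### Multilinear algebra: exterior products and powers -/

section Wedge

variable {V : Type*} [AddCommGroup V] [Module ℝ V]

/-- The exterior product `a ∧ b` of two alternating forms: the signed sum of `a ⊗ b` over shuffles. -/
def wedge {p q : ℕ} (a : V [⋀^Fin p]→ₗ[ℝ] ℝ) (b : V [⋀^Fin q]→ₗ[ℝ] ℝ) :
    V [⋀^Fin (p + q)]→ₗ[ℝ] ℝ :=
  ((LinearMap.mul' ℝ ℝ).compAlternatingMap (a.domCoprod b)).domDomCongr finSumFinEquiv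

/-- The `n`-th exterior power `θ ∧ ⋯ ∧ θ` of an alternating 2-form. -/
def wedgePow (θ : V [⋀^Fin 2]→ₗ[ℝ] ℝ) : (n : ℕ) → V [⋀^Fin (2 * n)]→ₗ[ℝ] ℝ
  | 0 => haveI : IsEmpty (Fin (2 * 0)) := inferInstanceAs (IsEmpty (Fin 0))
    AlternatingMap.constOfIsEmpty ℝ V (Fin (2 * 0)) 1
  | n + 1 => wedge (wedgePow θ n) θ

end Wedge

section TwoForm

variable {E : Type*} [NormedAddCommGroup E] [NormedSpace ℝ E]

/-- The alternating 2-form `(v, w) ↦ B v w` given by a continuous bilinear form with `B v v = 0`. -/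
def twoForm (B : E →L[ℝ] E →L[ℝ] ℝ) (hB : ∀ v, B v v = 0) : E [⋀^Fin 2]→L[ℝ] ℝ where
  toFun v := B (v 0) (v 1)
  map_update_add' v i a b := by
    fin_cases i <;> simp [Function.update]
  map_update_smul' v i c a := by
    fin_cases i <;> simp [Function.update]
  map_eq_zero_of_eq' v i j hij hne := by
    have h01 : v 0 = v 1 := by
      fin_cases i <;> fin_cases j <;> simp_all
    simp [h01, hB]
  cont := by
    change Continuous fun v : Fin 2 → E => B (v 0) (v 1)
    fun_prop

end TwoForm

section Manifold

variable {E : Type*} [NormedAddCommGroup E] [NormedSpace ℝ E]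
  {M : Type*} [TopologicalSpace M] [ChartedSpace E M]

/-! ### Tensor fields on a manifold `M` modelled on `E` -/

variable (E M) in
/-- (Not necessarily smooth) vector fields. -/
abbrev VField := (x : M) → TangentSpace 𝓘(ℝ, E) x

variable (E M) in
/-- (Not necessarily smooth) fields of endomorphisms of the tangent spaces. -/
abbrev EndField := (x : M) → TangentSpace 𝓘(ℝ, E) x →L[ℝ] TangentSpace 𝓘(ℝ, E) x

variable (E M) in
/-- (Not necessarily smooth) 1-forms. -/
abbrev OneForm := (x : M) → TangentSpace 𝓘(ℝ, E) x →L[ℝ] ℝ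

variable (E M) in
/-- (Not necessarily smooth) differential `k`-forms. -/
abbrev DForm (k : ℕ) := (x : M) → TangentSpace 𝓘(ℝ, E) x [⋀^Fin k]→L[ℝ] ℝ

/-- A 1-form viewed as a differential form of degree 1. -/
def OneForm.toDForm (η : OneForm E M) : DForm E M 1 :=
  fun x => ContinuousAlternatingMap.ofSubsingleton ℝ (TangentSpace 𝓘(ℝ, E) x) ℝ (0 : Fin 1) (η x)

/-- The pull-back of a form to the model space by the inverse of the preferred chart at `x₀`. -/
def DForm.inChart {k : ℕ} (θ : DForm E M k) (x₀ : M) : E → E [⋀^Fin k]→L[ℝ] ℝ :=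
  fun y => (θ ((extChartAt 𝓘(ℝ, E) x₀).symm y)).compContinuousLinearMap
    (mfderiv 𝓘(ℝ, E) 𝓘(ℝ, E) (extChartAt 𝓘(ℝ, E) x₀).symm y)

/-- A form is smooth if it is smooth in the charts. -/
def DForm.IsSmooth {k : ℕ} (θ : DForm E M k) : Prop :=
  ∀ x₀ : M, ContDiffOn ℝ ∞ (θ.inChart x₀) (extChartAt 𝓘(ℝ, E) x₀).target

/-- The exterior derivative, computed in the preferred chart at each point. It is normalized so that
`dη(X, Y) = X(η(Y)) - Y(η(X)) - η([X, Y])` for 1-forms. -/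
def DForm.d {k : ℕ} (θ : DForm E M k) : DForm E M (k + 1) :=
  fun x => (extDeriv (θ.inChart x) (extChartAt 𝓘(ℝ, E) x x)).compContinuousLinearMap
    (mfderiv 𝓘(ℝ, E) 𝓘(ℝ, E) (extChartAt 𝓘(ℝ, E) x) x)

/-- The form is closed. -/
def DForm.IsClosed {k : ℕ} (θ : DForm E M k) : Prop := ∀ x, θ.d x = 0

/-! ### Characteristic distribution and rank (Cartan class) of a 1-form -/

/-- The characteristic distribution `{X | i_X η = 0, i_X dη = 0}` of a 1-form. -/
def charDist (η : OneForm E M) (x : M) : Submodule ℝ (TangentSpace 𝓘(ℝ, E) x) where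
  carrier := {v | η x v = 0 ∧ ∀ w : TangentSpace 𝓘(ℝ, E) x, η.toDForm.d x ![v, w] = 0}
  zero_mem' := ⟨map_zero _, fun w =>
    (η.toDForm.d x).toMultilinearMap.map_coord_zero (m := ![0, w]) 0 rfl⟩
  add_mem' {a b} ha hb := ⟨by rw [map_add, ha.1, hb.1, add_zero], fun w => by
    have h := (η.toDForm.d x).toMultilinearMap.cons_add ![w] a b
    have ha' := ha.2 w
    have hb' := hb.2 w
    exact h.trans (by
      change η.toDForm.d x ![a, w] + η.toDForm.d x ![b, w] = 0
      rw [ha', hb', add_zero])⟩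
  smul_mem' c a ha := ⟨by rw [map_smul, ha.1, smul_zero], fun w => by
    have h := (η.toDForm.d x).toMultilinearMap.cons_smul ![w] c a
    have ha' := ha.2 w
    exact h.trans (by
      change c • η.toDForm.d x ![a, w] = 0
      rw [ha', smul_zero])⟩

/-- The Cartan class of a 1-form at a point: the codimension of its characteristic space. -/
def cartanClass (η : OneForm E M) (x : M) : ℕ :=
  Module.finrank ℝ (TangentSpace 𝓘(ℝ, E) x ⧸ charDist η x)

/-- The 1-form has constant rank `k`, i.e. Cartan class `k` at every point. -/
def HasRank (η : OneForm E M) (k : ℕ) : Prop := ∀ x, cartanClass η x = k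

/-! ### Linear combinations -/

/-- `∑ lam_α T_α`, for a family of tensor fields `T_α` of one kind. -/
def combo {N : ℕ} {F : M → Type*} [∀ x, AddCommMonoid (F x)] [∀ x, Module ℝ (F x)]
    (lam : EuclideanSpace ℝ (Fin N)) (T : Fin N → (x : M) → F x) : (x : M) → F x :=
  fun x => ∑ α, lam α • T α x

/-! ### Almost cosymplectic and quasi-contact spheres -/

/-- `(η, Ω)` is an almost cosymplectic structure: a smooth 1-form and a smooth 2-form on a manifold
of dimension `2n + 1` with `η ∧ Ωⁿ` nowhere zero. -/
def IsAlmostCosymplectic (η : OneForm E M) (Ω : DForm E M 2) : Prop :=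
  η.toDForm.IsSmooth ∧ Ω.IsSmooth ∧ ∃ n : ℕ, Module.finrank ℝ E = 2 * n + 1 ∧
    ∀ x, wedge (η.toDForm x).toAlternatingMap (wedgePow (Ω x).toAlternatingMap n) ≠ 0

/-- The pairs `(η_i, Ω_i)`, `i = 1, …, p + 1`, generate an almost cosymplectic `p`-sphere. -/
structure IsAlmostCosymplecticSphere {p : ℕ} (η : Fin (p + 1) → OneForm E M)
    (Ω : Fin (p + 1) → DForm E M 2) : Prop where
  generators : ∀ i, IsAlmostCosymplectic (η i) (Ω i)
  combos : ∀ lam ∈ Metric.sphere (0 : EuclideanSpace ℝ (Fin (p + 1))) 1,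
    IsAlmostCosymplectic (combo lam η) (combo lam Ω)

/-- The almost cosymplectic `p`-sphere generated by the `(η_i, Ω_i)` is quasi-contact of rank `k`. -/
structure IsQuasiContactSphere {p : ℕ} (η : Fin (p + 1) → OneForm E M)
    (Ω : Fin (p + 1) → DForm E M 2) (k : ℕ) : Prop extends IsAlmostCosymplecticSphere η Ω where
  closed : ∀ lam ∈ Metric.sphere (0 : EuclideanSpace ℝ (Fin (p + 1))) 1,
    DForm.IsClosed (combo lam Ω)
  rank_pos : 0 < k
  rank : ∀ lam ∈ Metric.sphere (0 : EuclideanSpace ℝ (Fin (p + 1))) 1,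
    HasRank (combo lam η) k

/-! ### Almost contact metric structures -/

variable [IsManifold 𝓘(ℝ, E) ∞ M]

/-- Smooth vector fields. -/
def VField.IsSmooth (X : VField E M) : Prop :=
  ContMDiff 𝓘(ℝ, E) (𝓘(ℝ, E).prod 𝓘(ℝ, E)) ∞
    (fun x => (TotalSpace.mk' E x (X x) : TangentBundle 𝓘(ℝ, E) M))

/-- Smooth fields of endomorphisms, i.e. smooth sections of `Hom(TM, TM)`. -/
def EndField.IsSmooth (φ : EndField E M) : Prop :=
  ContMDiff 𝓘(ℝ, E) (𝓘(ℝ, E).prod 𝓘(ℝ, E →L[ℝ] E)) ∞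
    (fun x => TotalSpace.mk' (E →L[ℝ] E)
      (E := fun x : M => TangentSpace 𝓘(ℝ, E) x →L[ℝ] TangentSpace 𝓘(ℝ, E) x) x (φ x))

variable (E M) in
/-- Smooth Riemannian metrics. -/
abbrev RMetric := ContMDiffRiemannianMetric 𝓘(ℝ, E) ∞ E (fun x : M => TangentSpace 𝓘(ℝ, E) x)

/-- Almost contact structures: `φ² = -I + η ⊗ ξ` and `η(ξ) = 1`. -/
structure IsAlmostContact (φ : EndField E M) (ξ : VField E M) (η : OneForm E M) : Prop where
  smooth_φ : φ.IsSmooth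
  smooth_ξ : ξ.IsSmooth
  smooth_η : η.toDForm.IsSmooth
  φ_sq : ∀ x v, φ x (φ x v) = -v + η x v • ξ x
  η_ξ : ∀ x, η x (ξ x) = 1

/-- Almost contact metric structures: `g(φX, φY) = g(X, Y) - η(X) η(Y)`. -/
structure IsAlmostContactMetric (φ : EndField E M) (ξ : VField E M) (η : OneForm E M)
    (g : RMetric E M) : Prop extends IsAlmostContact φ ξ η where
  compatible : ∀ x v w, g.inner x (φ x v) (φ x w) = g.inner x v w - η x v * η x w

/-- For an almost contact metric structure, `g(X, φY)` is an alternating form. -/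
theorem IsAlmostContactMetric.inner_φ_self {φ : EndField E M} {ξ : VField E M} {η : OneForm E M}
    {g : RMetric E M} (h : IsAlmostContactMetric φ ξ η g) (x : M) (v : TangentSpace 𝓘(ℝ, E) x) :
    g.inner x v (φ x v) = 0 := by
  have hξ0 : ξ x ≠ 0 := fun h0 => by
    have h1 := h.η_ξ x
    rw [h0, map_zero] at h1
    exact zero_ne_one h1
  have hφφξ : φ x (φ x (ξ x)) = 0 := by rw [h.φ_sq, h.η_ξ, one_smul, neg_add_cancel]
  have h1 : φ x (ξ x) = η x (φ x (ξ x)) • ξ x := by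
    have h2 := h.φ_sq x (φ x (ξ x))
    rw [hφφξ, map_zero] at h2
    exact (neg_add_eq_zero.mp h2.symm)
  have h3 : η x (φ x (ξ x)) = 0 := by
    have h4 : η x (φ x (ξ x)) • (η x (φ x (ξ x)) • ξ x) = 0 := by
      rw [← h1, ← map_smul, ← h1, hφφξ]
    rcases smul_eq_zero.mp h4 with h5 | h5
    · exact h5
    · exact (smul_eq_zero.mp h5).resolve_right hξ0
  have hφξ : φ x (ξ x) = 0 := by rw [h1, h3, zero_smul]
  have hηφ : η x (φ x v) = 0 := by
    have h6 := h.φ_sq x (φ x v)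
    rw [h.φ_sq x v, map_add, map_neg, map_smul, hφξ, smul_zero, add_zero] at h6
    exact (smul_eq_zero.mp (left_eq_add.mp h6)).resolve_right hξ0
  have hgξ : g.inner x (φ x v) (ξ x) = 0 := by
    have h7 := h.compatible x (φ x v) (ξ x)
    rw [hφξ, map_zero, hηφ, zero_mul, sub_zero] at h7
    exact h7.symm
  have h8 := h.compatible x v (φ x v)
  rw [hηφ, mul_zero, sub_zero, h.φ_sq, map_add, map_neg, map_smul, hgξ, smul_zero, add_zero,
    g.symm x (φ x v) v] at h8
  linarith

/-- The fundamental 2-form `Ω(X, Y) = g(X, φY)`. -/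
def IsAlmostContactMetric.fundamentalForm {φ : EndField E M} {ξ : VField E M} {η : OneForm E M}
    {g : RMetric E M} (h : IsAlmostContactMetric φ ξ η g) : DForm E M 2 :=
  fun x => twoForm (E := E) ((ContinuousLinearMap.compL ℝ E E ℝ).flip (φ x) ∘L g.inner x)
    (h.inner_φ_self x)

theorem IsAlmostContactMetric.fundamentalForm_apply {φ : EndField E M} {ξ : VField E M}
    {η : OneForm E M} {g : RMetric E M} (h : IsAlmostContactMetric φ ξ η g) (x : M)
    (v w : TangentSpace 𝓘(ℝ, E) x) : h.fundamentalForm x ![v, w] = g.inner x v (φ x w) := rfl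

/-- Normality: the Nijenhuis torsion of `φ` satisfies `[φ, φ] + dη ⊗ ξ = 0`, i.e. the almost complex
structure `J(X, f ∂ₜ) = (φX - f ξ, η(X) ∂ₜ)` on `M × ℝ` is integrable. The coefficient of `dη` is `1`
with the present normalization of `d`, and `2` if `d` on 1-forms carries a factor `1/2`. -/
def IsNormal (φ : EndField E M) (ξ : VField E M) (η : OneForm E M) : Prop :=
  ∀ X Y : VField E M, X.IsSmooth → Y.IsSmooth → ∀ x : M,
    mlieBracket 𝓘(ℝ, E) (fun y => φ y (X y)) (fun y => φ y (Y y)) x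
      - φ x (mlieBracket 𝓘(ℝ, E) (fun y => φ y (X y)) Y x)
      - φ x (mlieBracket 𝓘(ℝ, E) X (fun y => φ y (Y y)) x)
      + φ x (φ x (mlieBracket 𝓘(ℝ, E) X Y x))
      + η.toDForm.d x ![X x, Y x] • ξ x = 0

/-- Quasi-Sasakian structures: normal almost contact metric structures with closed fundamental
2-form. -/
structure IsQuasiSasakian (φ : EndField E M) (ξ : VField E M) (η : OneForm E M)
    (g : RMetric E M) : Prop extends IsAlmostContactMetric φ ξ η g where
  normal : IsNormal φ ξ η
  closed : toIsAlmostContactMetric.fundamentalForm.IsClosed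

/-! ### 3-structures -/

/-- The relations of an almost contact 3-structure. The even permutations `(α, β, γ)` of the three
indices are the triples `(α, α + 1, α + 2)` modulo 3. -/
structure ThreeStructureRelations (φ : Fin 3 → EndField E M) (ξ : Fin 3 → VField E M)
    (η : Fin 3 → OneForm E M) : Prop where
  φ_left : ∀ (α : Fin 3) (x : M) (v : TangentSpace 𝓘(ℝ, E) x),
    φ (α + 2) x v = φ α x (φ (α + 1) x v) - η (α + 1) x v • ξ α x
  φ_right : ∀ (α : Fin 3) (x : M) (v : TangentSpace 𝓘(ℝ, E) x),
    φ (α + 2) x v = -φ (α + 1) x (φ α x v) + η α x v • ξ (α + 1) x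
  ξ_left : ∀ (α : Fin 3) (x : M), ξ (α + 2) x = φ α x (ξ (α + 1) x)
  ξ_right : ∀ (α : Fin 3) (x : M), ξ (α + 2) x = -φ (α + 1) x (ξ α x)
  η_left : ∀ (α : Fin 3) (x : M) (v : TangentSpace 𝓘(ℝ, E) x),
    η (α + 2) x v = η α x (φ (α + 1) x v)
  η_right : ∀ (α : Fin 3) (x : M) (v : TangentSpace 𝓘(ℝ, E) x),
    η (α + 2) x v = -η (α + 1) x (φ α x v)

/-- 3-quasi-Sasakian structures: almost contact metric 3-structures all of whose three members are
quasi-Sasakian. -/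
structure IsThreeQuasiSasakian (φ : Fin 3 → EndField E M) (ξ : Fin 3 → VField E M)
    (η : Fin 3 → OneForm E M) (g : RMetric E M) : Prop
    extends ThreeStructureRelations φ ξ η where
  quasiSasakian : ∀ α, IsQuasiSasakian (φ α) (ξ α) (η α) g

/-- A 3-quasi-Sasakian manifold has rank `k` if `η₁, η₂, η₃` have the same constant rank `k`. -/
structure IsThreeQuasiSasakianOfRank (φ : Fin 3 → EndField E M) (ξ : Fin 3 → VField E M)
    (η : Fin 3 → OneForm E M) (g : RMetric E M) (k : ℕ) : Prop
    extends IsThreeQuasiSasakian φ ξ η g where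
  rank : ∀ α, HasRank (η α) k

/-- The fundamental 2-forms `Ω_α = g(·, φ_α ·)` of a 3-quasi-Sasakian structure. -/
def IsThreeQuasiSasakian.Ω {φ : Fin 3 → EndField E M} {ξ : Fin 3 → VField E M}
    {η : Fin 3 → OneForm E M} {g : RMetric E M} (h : IsThreeQuasiSasakian φ ξ η g) :
    Fin 3 → DForm E M 2 :=
  fun α => (h.quasiSasakian α).fundamentalForm

/-- The distribution `{X | i_X η_α = 0, i_X dη_α = 0 for α = 1, 2, 3}`. -/
def commonCharDist (η : Fin 3 → OneForm E M) (x : M) : Submodule ℝ (TangentSpace 𝓘(ℝ, E) x) :=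
  ⨅ α, charDist (η α) x

end Manifold

end QuasiContact

end

/-! The argument is pointwise, in the preferred chart, where Christoffel symbols provide a
torsion-free metric connection ∇. For one quasi-Sasakian structure put B = ∇ξ. Normality and dΩ = 0
force B to be skew and to commute with φ, and they determine ∇φ: (∇_u φ)v = g(φBu, v) ξ - η(v) φBu
(`IsQuasiSasakianJet.P_eq`). This is the analogue of the Kähler fact that J is parallel when it is
integrable and its 2-form is closed.

For three structures tied by the quaternionic relations, the operators -φ_α∇ξ_α differ only by
vertical terms. After subtracting c η_α ⊗ ξ_α with one constant c, they become a single symmetric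
operator A commuting with every φ_α, and ∇_u ξ_α = φ_α A u, (∇_u φ_α)v = η_α(v) A u - g(Au, v) ξ_α
(`IsLinearThreeStructure.exists_commutingSymm`). As A does not depend on α, these formulas are
linear in the structure and pass to φ_λ, ξ_λ, η_λ. They imply normality algebraically; Ω_λ is closed
by linearity, and the pointwise identities use |λ| = 1.

Moreover dη_λ(u, v) = 2 g(φ_λ A u, v), so the characteristic space of η_λ is ker η_λ ∩ ker A.
Commutation gives A ξ_α = a ξ_α with a common eigenvalue a. If a = 0, the rank of η_α would be rank
A + 1, and the image of A, being orthogonal to the ξ_α and invariant under the φ_α, has dimension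
divisible by 4; this contradicts rank 4l + 3 (`IsLinearThreeStructure.eigenvalue_ne_zero`). Hence a
≠ 0, ker A lies in ker η_λ by symmetry of A, and every characteristic space equals ker A.

For the volume condition, η_λ ∧ Ω_λⁿ is positive on ξ_λ followed by orthogonal pairs φe_i, e_i in
ker η_λ (`wedgePow_pos`). -/

noncomputable section

namespace QuasiContact

/-! ### Pointwise algebra of a single quasi-Sasakian structure -/

section JetAlgebra

variable {E : Type*} [NormedAddCommGroup E] [NormedSpace ℝ E]

/-- An almost contact metric structure on a vector space, with `η = g(ξ, ·)`. -/
structure IsLinearContactMetric (g : E →L[ℝ] E →L[ℝ] ℝ) (φ : E →L[ℝ] E) (ξ : E) : Prop where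
  symm : ∀ u v, g u v = g v u
  pos : ∀ v, v ≠ 0 → 0 < g v v
  sq : ∀ v, φ (φ v) = -v + g ξ v • ξ
  map_ξ : φ ξ = 0
  skew : ∀ u v, g (φ u) v = -g u (φ v)
  unit : g ξ ξ = 1

/-- The identities satisfied at a point by `P = ∇φ` and `B = ∇ξ` for a torsion-free metric
connection `∇` and a quasi-Sasakian structure `(φ, ξ, g(ξ, ·), g)`. -/
structure IsQuasiSasakianJet (g : E →L[ℝ] E →L[ℝ] ℝ) (φ : E →L[ℝ] E) (ξ : E)
    (P : E → E →L[ℝ] E) (B : E →L[ℝ] E) : Prop extends IsLinearContactMetric g φ ξ where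
  -- Linearity of `P` in the direction is never needed, only its value at `φ ξ = 0`.
  P_zero : P 0 = 0
  deriv_sq : ∀ u v, P u (φ v) + φ (P u v) = g (B u) v • ξ + g ξ v • B u
  deriv_skew : ∀ u v w, g (P u v) w = -g v (P u w)
  deriv_map_ξ : ∀ u, P u ξ = -φ (B u)
  deriv_unit : ∀ u, g ξ (B u) = 0
  normal : ∀ u v, P (φ u) v - P (φ v) u + φ (P v u) - φ (P u v) + (g (B u) v - g (B v) u) • ξ = 0
  closed : ∀ u v w, g v (P u w) - g u (P v w) + g u (P w v) = 0

namespace IsLinearContactMetric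

variable {g : E →L[ℝ] E →L[ℝ] ℝ} {φ : E →L[ℝ] E} {ξ : E} (h : IsLinearContactMetric g φ ξ)

include h

theorem ext {u v : E} (huv : ∀ w, g u w = g v w) : u = v := by
  by_contra hne
  have h1 := h.pos (u - v) (sub_ne_zero.2 hne)
  have h2 := huv (u - v)
  simp only [map_sub, sub_apply] at h1 h2
  linarith

theorem η_map (v : E) : g ξ (φ v) = 0 := by
  have h1 := h.skew ξ v
  rw [h.map_ξ, map_zero, zero_apply] at h1
  linarith

theorem compatible (u v : E) : g (φ u) (φ v) = g u v - g ξ u * g ξ v := by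
  rw [h.skew, h.sq]
  simp only [map_add, map_neg, map_smul, smul_eq_mul, h.symm u ξ]
  ring

end IsLinearContactMetric

namespace IsQuasiSasakianJet

variable {g : E →L[ℝ] E →L[ℝ] ℝ} {φ : E →L[ℝ] E} {ξ : E} {P : E → E →L[ℝ] E} {B : E →L[ℝ] E}
  (h : IsQuasiSasakianJet g φ ξ P B)

include h

theorem normal_apply (u v w : E) : g (P (φ u) v) w - g (P (φ v) u) w - g (P v u) (φ w)
    + g (P u v) (φ w) + (g (B u) v - g (B v) u) * g ξ w = 0 := by
  have h1 := congrArg (fun z => g z w) (h.normal u v)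
  simp only [map_add, map_sub, map_smul, add_apply, map_zero,
    sub_apply, smul_apply, smul_eq_mul,
    zero_apply, h.skew] at h1
  linarith

/-- In normality at `(w, ξ)` paired with `ξ`, only the dη term survives; as `B w` is orthogonal to
`ξ`, it reduces to `g (B ξ) w`. -/
theorem B_ξ : B ξ = 0 := by
  refine h.ext fun w => ?_
  have h1 := h.normal_apply w ξ ξ
  rw [h.map_ξ, h.P_zero, h.deriv_map_ξ, h.deriv_map_ξ, h.unit, h.symm (B w), h.deriv_unit,
    map_neg, neg_apply, h.symm _ ξ, h.η_map] at h1
  simp only [map_zero, zero_apply] at h1 ⊢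
  linarith

theorem η_P (u v : E) : g (P u v) ξ = g (φ (B u)) v := by
  rw [h.deriv_skew, h.deriv_map_ξ, map_neg, neg_neg, h.symm]

theorem P_ξ (u v : E) : g (P ξ u) v = g (φ (B v)) u - g (φ (B u)) v := by
  have h1 := h.closed ξ v u
  rw [h.symm v, h.symm ξ, h.symm ξ, h.η_P, h.η_P] at h1
  linarith

theorem B_eq_neg (u : E) : B u = -B (φ (φ u)) := by
  rw [h.sq, map_add, map_neg, map_smul, h.B_ξ, smul_zero, add_zero, neg_neg]

theorem g_B_eq_neg (u v : E) : g (B u) v = -g (B u) (φ (φ v)) := by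
  rw [h.sq, map_add, map_neg, map_smul, h.symm _ ξ, h.deriv_unit, smul_zero, add_zero, neg_neg]

/-- This says that `ξ` is Killing. Normality at `(u, ξ)`, with the derivative of `φ` along `ξ`
eliminated by closedness, gives skewness on the image of `φ`. Since `B` kills `ξ` and takes values
orthogonal to it, both arguments may be replaced by minus their images under `φ²`. -/
theorem B_skew (u v : E) : g (B u) v = -g u (B v) := by
  have key : ∀ u w, g (B (φ u)) (φ w) + g (B (φ w)) (φ u) = 0 := fun u w => by
    have h1 := h.normal_apply u ξ w
    rw [h.map_ξ, h.P_zero, h.deriv_map_ξ, h.deriv_map_ξ, h.P_ξ, h.B_ξ, h.symm _ ξ,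
      h.deriv_unit, h.skew (B (φ w))] at h1
    simp only [map_neg, neg_apply, map_zero, zero_apply, h.skew (B (φ u)) w] at h1
    linarith
  have h1 := key (φ u) (φ v)
  rw [h.symm u, h.g_B_eq_neg u v, h.g_B_eq_neg v u, h.B_eq_neg u, h.B_eq_neg v]
  simp only [map_neg, neg_apply]
  linarith

theorem φ_φ_B (u : E) : φ (φ (B u)) = -B u := by
  rw [h.sq, h.deriv_unit, zero_smul, add_zero]

/-- The `ξ`-component of normality reads `φ B φ = -B`; this is commutation, because `φ² = -1` on the
range of `B`. -/
theorem φ_B (u : E) : φ (B u) = B (φ u) := by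
  have key : φ (B (φ u)) = -B u := h.ext fun v => by
    have h1 := h.normal_apply u v ξ
    rw [h.map_ξ, h.η_P, h.η_P, h.unit, map_zero, map_zero, h.skew _ u, h.B_skew (φ v),
      h.skew v, h.B_skew v, h.symm v, h.symm v] at h1
    simp only [map_neg, neg_apply]
    linarith
  rw [← neg_inj, ← map_neg, ← key, h.φ_φ_B]

theorem φ_B_symm (u v : E) : g (φ (B u)) v = g u (φ (B v)) := by
  rw [h.skew, h.B_skew, h.φ_B, neg_neg]

theorem P_eq (u v : E) : P u v = g (φ (B u)) v • ξ - g ξ v • φ (B u) := by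
  -- The defect of the claimed formula. It inherits homogeneous versions of all the identities,
  -- namely those of ∇J for an integrable almost Hermitian structure with closed 2-form, and it
  -- vanishes on `ξ`.
  set q : E → E → E → ℝ := fun u v w =>
    g (P u v) w - (g (φ (B u)) v * g ξ w - g ξ v * g (φ (B u)) w) with hq
  have q_skew : ∀ u v w, q u v w = -q u w v := fun u v w => by
    have h1 := h.deriv_skew u v w
    rw [h.symm v] at h1
    simp only [hq]; linarith
  have η_φB : ∀ u, g (φ (B u)) ξ = 0 := fun u => by rw [h.symm, h.η_map]
  have q_ξ : ∀ u v, q u v ξ = 0 := fun u v => by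
    simp only [hq, h.η_P, h.unit, η_φB]; ring
  have q_φ : ∀ u v w, q u (φ v) w = q u v (φ w) := fun u v w => by
    have h1 := congrArg (fun z => g z w) (h.deriv_sq u v)
    simp only [map_add, map_smul, add_apply, smul_apply, smul_eq_mul, h.skew (P u v)] at h1
    have h2 : ∀ v, g (φ (B u)) (φ v) = g (B u) v := fun v => by
      rw [h.compatible, h.deriv_unit, zero_mul, sub_zero]
    simp only [hq, h.η_map, h2]
    linarith
  have q_cyc : ∀ u v w, q u v w + q v w u + q w u v = 0 := fun u v w => by
    have h1 := h.closed u v w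
    have h2 := h.φ_B_symm u v
    have h3 := h.φ_B_symm v w
    have h4 := h.φ_B_symm w u
    have h5 := h.deriv_skew u v w
    have h6 := h.deriv_skew w u v
    rw [h.symm u] at h1 h2
    rw [h.symm v] at h3
    rw [h.symm w] at h4
    simp only [hq]
    rw [h2, h3, h4]
    linarith
  have q_normal : ∀ u v w, q (φ u) v w - q (φ v) u w - q v u (φ w) + q u v (φ w) = 0 :=
    fun u v w => by
    have h1 := h.normal_apply u v w
    have h2 : ∀ u, φ (B (φ u)) = - B u := fun u => by rw [← h.φ_B, h.φ_φ_B]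
    have h3 : ∀ u v, g (φ (B u)) (φ v) = g (B u) v := fun u v => by
      rw [h.compatible, h.deriv_unit, zero_mul, sub_zero]
    simp only [hq, h2, h3, h.η_map, map_neg, neg_apply]
    linarith
  have q_φφ : ∀ u v w, q u (φ v) (φ w) = -q u v w := fun u v w => by
    rw [q_φ]
    have h1 := q_ξ u v
    simp only [hq] at h1 ⊢
    simp only [h.sq, map_add, map_neg, map_smul, smul_eq_mul] 
    linear_combination (g ξ w) * h1
  have q_zero : ∀ u v w, q u v w = 0 := fun u v w => by
    -- The cyclic identity at `(u, φ v, φ w)` turns the normality identity at `(v, w, φ u)` into `q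
    -- u v w = q v w u + q w u v`. The cyclic identity at `(u, v, w)` then gives `2 * q u v w = 0`.
    have c1 := q_cyc u (φ v) (φ w)
    have c2 := q_cyc u v w
    have n1 := q_normal v w (φ u)
    have e1 : ∀ a b c, q a b (φ (φ c)) = -q a b c := fun a b c => by rw [← q_φ, q_φφ]
    rw [e1, e1, ← q_φ, ← q_φ, q_skew (φ w) (φ v) u] at n1
    have e2 := q_φφ u v w
    have e3 := q_skew w v u
    linarith
  refine h.ext fun w => ?_
  have h1 := q_zero u v w
  simp only [hq] at h1
  simp only [map_sub, map_smul, sub_apply, smul_apply, smul_eq_mul]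
  linarith

end IsQuasiSasakianJet

end JetAlgebra

/-! ### Pointwise algebra of a 3-structure: the common operator and its eigenvalue -/

section ThreeStructure

variable {E : Type*} [NormedAddCommGroup E] [NormedSpace ℝ E]

/-- An almost contact metric 3-structure on a vector space, with `η α = g(ξ α, ·)`. -/
structure IsLinearThreeStructure (g : E →L[ℝ] E →L[ℝ] ℝ) (φ : Fin 3 → E →L[ℝ] E)
    (ξ : Fin 3 → E) : Prop where
  contactMetric : ∀ α, IsLinearContactMetric g (φ α) (ξ α)
  φ_left : ∀ α v, φ (α + 2) v = φ α (φ (α + 1) v) - g (ξ (α + 1)) v • ξ α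
  φ_right : ∀ α v, φ (α + 2) v = -φ (α + 1) (φ α v) + g (ξ α) v • ξ (α + 1)
  ξ_left : ∀ α, ξ (α + 2) = φ α (ξ (α + 1))
  ξ_right : ∀ α, ξ (α + 2) = -φ (α + 1) (ξ α)

/-- A symmetric operator commuting with the three structure endomorphisms. -/
structure IsCommutingSymm (g : E →L[ℝ] E →L[ℝ] ℝ) (φ : Fin 3 → E →L[ℝ] E)
    (A : E →L[ℝ] E) : Prop where
  symm : ∀ u v, g (A u) v = g u (A v)
  comm : ∀ α u, φ α (A u) = A (φ α u)

theorem fin_three_add (α : Fin 3) :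
    α + 1 + 1 = α + 2 ∧ α + 1 + 2 = α ∧ α + 2 + 1 = α ∧ α + 2 + 2 = α + 1 := by
  fin_cases α <;> decide

/-- The pair `I`, `J` makes `V` a quaternionic vector space, whose real dimension is four times its
quaternionic one. -/
theorem four_dvd_finrank {V : Type*} [AddCommGroup V] [Module ℝ V]
    [FiniteDimensional ℝ V] (I J : V →ₗ[ℝ] V) (hI : ∀ v, I (I v) = -v) (hJ : ∀ v, J (J v) = -v)
    (hIJ : ∀ v, J (I v) = -I (J v)) : 4 ∣ Module.finrank ℝ V := by
  let q : QuaternionAlgebra.Basis (Module.End ℝ V) (-1 : ℝ) (0 : ℝ) (-1 : ℝ) :=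
    { i := I
      j := J
      k := I * J
      i_mul_i := by ext v; simp [hI]
      j_mul_j := by ext v; simp [hJ]
      i_mul_j := rfl
      j_mul_i := by ext v; simp [hIJ] }
  let f : Quaternion ℝ →ₐ[ℝ] Module.End ℝ V := q.liftHom
  let _ : Module (Quaternion ℝ) V := Module.compHom V f.toRingHom
  have : IsScalarTower ℝ (Quaternion ℝ) V := ⟨fun r x v => by
    change f (r • x) v = r • f x v
    rw [map_smul]; rfl⟩
  have h1 := Module.finrank_mul_finrank ℝ (Quaternion ℝ) V
  rw [Quaternion.finrank_eq_four] at h1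
  exact ⟨_, h1.symm⟩

namespace IsLinearThreeStructure

variable {g : E →L[ℝ] E →L[ℝ] ℝ} {φ : Fin 3 → E →L[ℝ] E} {ξ : Fin 3 → E}
  (h : IsLinearThreeStructure g φ ξ)

include h

theorem g_ξ_succ (α : Fin 3) : g (ξ α) (ξ (α + 1)) = 0 := by
  obtain ⟨-, h2, -, -⟩ := fin_three_add α
  have h1 := h.ξ_left (α + 1)
  rw [h2] at h1
  rw [h1, (h.contactMetric _).skew, (h.contactMetric _).map_ξ, map_zero, neg_zero]

/-- The covariant derivatives of a 3-quasi-Sasakian structure are given by one symmetric operator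
commuting with the structure. -/
theorem exists_commutingSymm {P : Fin 3 → E → E →L[ℝ] E} {B : Fin 3 → E →L[ℝ] E}
    (hJ : ∀ α, IsQuasiSasakianJet g (φ α) (ξ α) (P α) (B α))
    (hB : ∀ α u, B (α + 2) u = P α u (ξ (α + 1)) + φ α (B (α + 1) u)) :
    ∃ A : E →L[ℝ] E, IsCommutingSymm g φ A ∧ (∀ α u, B α u = φ α (A u)) ∧
      ∀ α u v, P α u v = g (ξ α) v • A u - g (A u) v • ξ α := by
  -- The derivative of `ξ α = φ (α + 1) (ξ (α + 2))`, with `P (α + 1)` replaced by its value from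
  -- `P_eq`.
  have B_eq : ∀ α u, B α u = φ (α + 1) (B (α + 2) u) - g (B (α + 1) u) (ξ α) • ξ (α + 1) := by
    intro α u
    obtain ⟨h1, h2, -, -⟩ := fin_three_add α
    have h3 := hB (α + 1) u
    have h4 := h.ξ_left (α + 1)
    have h5 := h.g_ξ_succ (α + 1)
    rw [h2, h1] at h3 h4
    rw [h1] at h5
    rw [(hJ (α + 1)).P_eq, h5, zero_smul, (hJ _).skew, ← h4] at h3
    rw [h3]
    module
  have t_skew : ∀ α u, g (B α u) (ξ (α + 1)) = -g (B (α + 1) u) (ξ α) := fun α u => by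
    rw [B_eq α u, map_sub, map_smul, sub_apply, smul_apply, (hJ _).unit, (hJ _).skew,
      (hJ _).map_ξ]
    simp
  set T : Fin 3 → E → ℝ := fun α u => g (B (α + 1) u) (ξ (α + 2)) with hT
  have hT2 : ∀ α u, T (α + 2) u = g (B α u) (ξ (α + 1)) := fun α u => by
    obtain ⟨-, -, h3, h4⟩ := fin_three_add α
    simp only [hT, h3, h4]
  -- The operators `φ α ∘ B α` agree up to vertical terms, governed by the rotation coefficients `T`
  -- of the frame `ξ`.
  have C_sub : ∀ α u, φ (α + 2) (B (α + 2) u) - φ α (B α u) =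
      T α u • ξ α - T (α + 2) u • ξ (α + 2) := fun α u => by
    have h1 := t_skew (α + 1) u
    obtain ⟨h2, h3, -, -⟩ := fin_three_add α
    rw [h2] at h1
    rw [h.φ_left α, B_eq α u, map_sub, map_smul, ← h.ξ_left, hT2, t_skew,
      (hJ 0).symm (ξ (α + 1)) (B (α + 2) u)]
    simp only [hT]
    rw [h1]
    module
  -- Each `φ α ∘ B α` is symmetric, so `C_sub` at `u` paired with `ξ α` equals `C_sub` at `ξ α`
  -- paired with `u`; there `T (α + 2) (ξ α)` vanishes because `B α (ξ α) = 0`.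
  have T_eq : ∀ α u, T α u = T α (ξ α) * g (ξ α) u := fun α u => by
    have h1 := congrArg (fun z => g z (ξ α)) (C_sub α u)
    have h2 := congrArg (fun z => g z u) (C_sub α (ξ α))
    have h3 : g (ξ (α + 2)) (ξ α) = 0 := by
      have := h.g_ξ_succ (α + 2)
      rwa [(fin_three_add α).2.2.1] at this
    simp only [map_sub, map_smul, sub_apply, smul_apply, smul_eq_mul, h3, (hJ _).unit] at h1 h2
    rw [(hJ _).φ_B_symm, (hJ _).φ_B_symm, (hJ 0).symm u, (hJ 0).symm u, h2, hT2 α (ξ α),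
      (hJ α).B_ξ, map_zero, zero_apply] at h1
    linarith
  -- Skewness of `B (α + 1)` makes the three remaining coefficients one constant.
  have T_ξ : ∀ α, T α (ξ α) = T (α + 2) (ξ (α + 2)) := fun α => by
    rw [hT2, t_skew]
    simp only [hT]
    rw [(hJ _).B_skew, (hJ 0).symm]
  set c := T 0 (ξ 0) with hc
  have c_eq : ∀ α, T α (ξ α) = c := by
    have h0 := T_ξ 0
    have h1 := T_ξ 1
    intro α
    fin_cases α
    · rfl
    · exact h1
    · exact h0.symm
  -- The correction by `c` absorbs the right-hand side of `C_sub`, so any index would give the same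
  -- operator.
  set A : E →L[ℝ] E := -(φ 0 ∘L B 0) - c • (g (ξ 0)).smulRight (ξ 0) with hA
  have A_eq : ∀ α u, A u = -φ α (B α u) - (c * g (ξ α) u) • ξ α := by
    have h0 : ∀ u, A u = -φ 0 (B 0 u) - (c * g (ξ 0) u) • ξ 0 := fun u => by
      simp [hA, smul_smul]
    intro α u
    have h2 := C_sub 0 u
    have h1 := C_sub 1 u
    rw [T_eq 0, T_eq (0 + 2), c_eq, c_eq] at h2
    rw [T_eq 1, T_eq (1 + 2), c_eq, c_eq] at h1
    rw [h0]
    fin_cases α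
    · rfl
    · change φ 0 (B 0 u) - φ 1 (B 1 u) =
        (c * g (ξ 1) u) • ξ 1 - (c * g (ξ 0) u) • ξ 0 at h1
      change _ = -φ 1 (B 1 u) - (c * g (ξ 1) u) • ξ 1
      linear_combination (norm := module) (-1 : ℝ) • h1
    · change φ 2 (B 2 u) - φ 0 (B 0 u) =
        (c * g (ξ 0) u) • ξ 0 - (c * g (ξ 2) u) • ξ 2 at h2
      change _ = -φ 2 (B 2 u) - (c * g (ξ 2) u) • ξ 2
      linear_combination (norm := module) (1 : ℝ) • h2
  refine ⟨A, ⟨fun u v => ?_, fun α u => ?_⟩, fun α u => ?_, fun α u v => ?_⟩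
  · rw [A_eq 0, A_eq 0]
    simp only [map_sub, map_neg, map_smul, sub_apply, neg_apply, smul_apply, smul_eq_mul,
      (hJ 0).φ_B_symm, (hJ 0).symm u (ξ 0)]
    ring
  · rw [A_eq α, A_eq α, map_sub, map_neg, map_smul, (hJ α).map_ξ, (hJ α).η_map, (hJ α).φ_B]
    simp
  · rw [A_eq α, map_sub, map_neg, map_smul, (hJ α).map_ξ, (hJ α).φ_φ_B]
    simp
  · rw [A_eq α, (hJ α).P_eq]
    simp only [map_sub, map_neg, map_smul, sub_apply, neg_apply, smul_apply, smul_eq_mul]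
    module

/-- `A (ξ α)` lies in the kernel of `φ α`, which is spanned by `ξ α`. The eigenvalue is common
because `φ α` commutes with `A` and carries `ξ (α + 1)` to `ξ (α + 2)`. -/
theorem exists_eigenvalue {A : E →L[ℝ] E} (hA : IsCommutingSymm g φ A) :
    ∃ a : ℝ, ∀ α, A (ξ α) = a • ξ α := by
  have key : ∀ α, A (ξ α) = g (ξ α) (A (ξ α)) • ξ α := fun α => by
    have h1 := (h.contactMetric α).sq (A (ξ α))
    rw [hA.comm, (h.contactMetric α).map_ξ, map_zero, map_zero] at h1
    exact neg_add_eq_zero.1 h1.symm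
  have step : ∀ α a, A (ξ (α + 1)) = a • ξ (α + 1) → A (ξ (α + 2)) = a • ξ (α + 2) :=
    fun α a ha => by rw [h.ξ_left, ← hA.comm, ha, map_smul]
  have h0 := key 0
  have h1 := step 2 _ h0
  have h2 := step 0 _ h1
  refine ⟨g (ξ 0) (A (ξ 0)), fun α => ?_⟩
  fin_cases α
  · exact h0
  · exact h1
  · exact h2

theorem four_dvd_finrank_of_invariant [FiniteDimensional ℝ E] (W : Submodule ℝ E)
    (hW : ∀ α, ∀ v ∈ W, φ α v ∈ W) (hη : ∀ α, ∀ v ∈ W, g (ξ α) v = 0) :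
    4 ∣ Module.finrank ℝ W := by
  have hsq : ∀ α, ∀ v ∈ W, φ α (φ α v) = -v := fun α v hv => by
    rw [(h.contactMetric α).sq, hη α v hv, zero_smul, add_zero]
  refine four_dvd_finrank ((φ 0).toLinearMap.restrict (hW 0)) ((φ 1).toLinearMap.restrict (hW 1))
    (fun v => Subtype.ext (hsq 0 v v.2)) (fun v => Subtype.ext (hsq 1 v v.2))
    fun v => Subtype.ext ?_
  have h1 := h.φ_left 0 v
  have h2 := h.φ_right 0 v
  rw [hη _ _ v.2, zero_smul] at h1 h2
  change φ 1 (φ 0 v) = -φ 0 (φ 1 v)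
  rw [sub_zero] at h1
  rw [add_zero, h1] at h2
  exact (neg_eq_iff_eq_neg.2 h2).symm

/-- The common kernel of the three 1-forms is quaternionic, and its codimension is 3 because the `ξ
α` are orthonormal. -/
theorem finrank_eq [FiniteDimensional ℝ E] : ∃ m, Module.finrank ℝ E = 4 * m + 3 := by
  let L : E →ₗ[ℝ] (Fin 3 → ℝ) := LinearMap.pi fun α => (g (ξ α)).toLinearMap
  have g01 := h.g_ξ_succ 0
  have g12 := h.g_ξ_succ 1
  have g20 := h.g_ξ_succ 2
  change g (ξ 0) (ξ 1) = 0 at g01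
  change g (ξ 1) (ξ 2) = 0 at g12
  change g (ξ 2) (ξ 0) = 0 at g20
  have g10 := (h.contactMetric 0).symm (ξ 1) (ξ 0)
  have g21 := (h.contactMetric 0).symm (ξ 2) (ξ 1)
  have g02 := (h.contactMetric 0).symm (ξ 0) (ξ 2)
  have hL : Function.Surjective L := fun c => ⟨∑ α, c α • ξ α, by
    ext β
    fin_cases β <;>
      simp [L, Fin.sum_univ_three, g01, g12, g20, g10, g21, g02, (h.contactMetric _).unit]⟩
  obtain ⟨m, hm⟩ := h.four_dvd_finrank_of_invariant (LinearMap.ker L) (fun α v hv => by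
    rw [LinearMap.mem_ker] at hv ⊢
    have h' : ∀ β, g (ξ β) v = 0 := fun β => congrFun hv β
    ext β
    change g (ξ β) (φ α v) = 0
    rw [← neg_eq_zero, ← (h.contactMetric α).skew]
    have l0 := h.ξ_left α
    have r0 := h.ξ_right (α + 2)
    obtain ⟨-, -, h3, h4⟩ := fin_three_add α
    rw [h3, h4] at r0
    have : β = α ∨ β = α + 1 ∨ β = α + 2 := by fin_cases α <;> fin_cases β <;> decide
    rcases this with rfl | rfl | rfl
    · rw [(h.contactMetric _).map_ξ]; simp
    · rw [← l0, h']
    · rw [← neg_eq_iff_eq_neg.2 r0, map_neg, neg_apply, h', neg_zero])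
    (fun α v hv => congrFun (LinearMap.mem_ker.1 hv) α)
  have h1 := L.finrank_range_add_finrank_ker
  rw [LinearMap.range_eq_top.2 hL, finrank_top, Module.finrank_fin_fun, hm] at h1
  exact ⟨m, by omega⟩

/-- In the square of the combination the mixed products reduce to φ_αφ_β + φ_βφ_α = η_β ⊗ ξ_α + η_α
⊗ ξ_β, which are the cross terms of η_λ ⊗ ξ_λ; the diagonal gives -|λ|² = -1. -/
theorem combo {lam : Fin 3 → ℝ} (hlam : ∑ α, lam α ^ 2 = 1) :
    IsLinearContactMetric g (∑ α, lam α • φ α) (∑ α, lam α • ξ α) := by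
  have hc := h.contactMetric
  have g01 : g (ξ 0) (ξ 1) = 0 := h.g_ξ_succ 0
  have g12 : g (ξ 1) (ξ 2) = 0 := h.g_ξ_succ 1
  have g20 : g (ξ 2) (ξ 0) = 0 := h.g_ξ_succ 2
  have g10 := (hc 0).symm (ξ 1) (ξ 0)
  have g21 := (hc 0).symm (ξ 2) (ξ 1)
  have g02 := (hc 0).symm (ξ 0) (ξ 2)
  have x01 : φ 0 (ξ 1) = ξ 2 := (h.ξ_left 0).symm
  have x12 : φ 1 (ξ 2) = ξ 0 := (h.ξ_left 1).symm
  have x20 : φ 2 (ξ 0) = ξ 1 := (h.ξ_left 2).symm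
  have x10 : φ 1 (ξ 0) = -ξ 2 := (neg_eq_iff_eq_neg.2 (h.ξ_right 0)).symm
  have x21 : φ 2 (ξ 1) = -ξ 0 := (neg_eq_iff_eq_neg.2 (h.ξ_right 1)).symm
  have x02 : φ 0 (ξ 2) = -ξ 1 := (neg_eq_iff_eq_neg.2 (h.ξ_right 2)).symm
  have p01 : ∀ v, φ 0 (φ 1 v) = φ 2 v + g (ξ 1) v • ξ 0 :=
    fun v => (eq_add_of_sub_eq (h.φ_left 0 v).symm)
  have p12 : ∀ v, φ 1 (φ 2 v) = φ 0 v + g (ξ 2) v • ξ 1 :=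
    fun v => (eq_add_of_sub_eq (h.φ_left 1 v).symm)
  have p20 : ∀ v, φ 2 (φ 0 v) = φ 1 v + g (ξ 0) v • ξ 2 :=
    fun v => (eq_add_of_sub_eq (h.φ_left 2 v).symm)
  have p10 : ∀ v, φ 1 (φ 0 v) = -φ 2 v + g (ξ 0) v • ξ 1 := fun v => by
    have h1 : φ 2 v = _ := h.φ_right 0 v
    rw [h1]; simp
  have p21 : ∀ v, φ 2 (φ 1 v) = -φ 0 v + g (ξ 1) v • ξ 2 := fun v => by
    have h1 : φ 0 v = _ := h.φ_right 1 v
    rw [h1]; simp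
  have p02 : ∀ v, φ 0 (φ 2 v) = -φ 1 v + g (ξ 2) v • ξ 0 := fun v => by
    have h1 : φ 1 v = _ := h.φ_right 2 v
    rw [h1]; simp
  rw [Fin.sum_univ_three] at hlam
  refine ⟨(hc 0).symm, (hc 0).pos, fun v => ?_, ?_, fun u v => ?_, ?_⟩
  · simp only [Fin.sum_univ_three, add_apply, smul_apply, map_add, map_smul, p01, p12, p20, p10,
      p21, p02, (hc _).sq]
    linear_combination (norm := module) hlam • (-v)
  · simp only [Fin.sum_univ_three, add_apply, smul_apply, map_add, map_smul, (hc _).map_ξ, x01,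
      x12, x20, x10, x21, x02]
    module
  · simp only [Fin.sum_univ_three, add_apply, smul_apply, map_add, map_smul, (hc _).skew,
      smul_eq_mul]
    ring
  · simp only [Fin.sum_univ_three, add_apply, smul_apply, map_add, map_smul, smul_eq_mul,
      (hc _).unit, g01, g12, g20, g10, g21, g02]
    linarith

end IsLinearThreeStructure

namespace IsLinearContactMetric

variable {g : E →L[ℝ] E →L[ℝ] ℝ} {ψ A : E →L[ℝ] E} {ζ : E} (h : IsLinearContactMetric g ψ ζ)
  (hs : ∀ u v, g (A u) v = g u (A v)) (hc : ∀ u, ψ (A u) = A (ψ u))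

include h hs hc in
-- Consequently dη, the antisymmetrization of this bilinear form, is twice the form itself.
theorem g_ψ_A_skew (u v : E) : g (ψ (A u)) v = -g (ψ (A v)) u := by
  rw [h.skew, hs, ← hc, h.symm u]

include h hc in
/-- The covariant derivative `∇ψ = ζ♭ ⊗ A - g(A·, ·) ζ` satisfies the normality condition. -/
theorem normal_of_operator {P : E → E →L[ℝ] E}
    (hP : ∀ u v, P u v = g ζ v • A u - g (A u) v • ζ) (u v : E) :
    P (ψ u) v - P (ψ v) u + ψ (P v u) - ψ (P u v)
      + (g (ψ (A u)) v - g (ψ (A v)) u) • ζ = 0 := by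
  simp only [hP, map_sub, map_smul, h.map_ξ, hc]
  module

include h hs hc in
-- The second condition on the left is i_v dη = 0, that is `ψ (A v) = 0`. Applying `ψ` once more
-- leaves only the component of `A v` along `ζ`, which is `a * g ζ v = 0`.
theorem charSpace_iff {a : ℝ} (ha : A ζ = a • ζ) (v : E) :
    (g ζ v = 0 ∧ ∀ w, g (ψ (A v)) w - g (ψ (A w)) v = 0) ↔ g ζ v = 0 ∧ A v = 0 := by
  refine and_congr_right fun hv => ⟨fun h1 => ?_, fun h1 w => ?_⟩
  · have h2 : ψ (A v) = 0 := h.ext fun w => by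
      have := h1 w
      rw [h.g_ψ_A_skew hs hc w v] at this
      simp only [map_zero, zero_apply]
      linarith
    have h3 := h.sq (A v)
    rwa [h2, map_zero, ← hs, ha, map_smul, smul_apply, hv, smul_zero, zero_smul, add_zero,
      zero_eq_neg] at h3
  · rw [h.g_ψ_A_skew hs hc w v, h1]; simp

end IsLinearContactMetric

/-- Makes the condition `g ζ v = 0` in `charSpace_iff` redundant, so that the characteristic space
no longer depends on `ζ`. -/
theorem eq_zero_of_map_eq_zero_of_symm {g : E →L[ℝ] E →L[ℝ] ℝ} {A : E →L[ℝ] E} {ζ : E}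
    (hs : ∀ u v, g (A u) v = g u (A v)) {a : ℝ} (ha : A ζ = a • ζ) (ha0 : a ≠ 0) {v : E}
    (hv : A v = 0) : g ζ v = 0 := by
  have h1 := hs ζ v
  rw [ha, hv, map_smul, map_zero, smul_apply, smul_eq_mul] at h1
  exact (mul_eq_zero.1 h1).resolve_left ha0

/-- The codimension of `ker η ∩ ker A` when `ζ ∈ ker A` and `η ζ ≠ 0`. -/
theorem finrank_quotient_ker_inf_ker [FiniteDimensional ℝ E] (η : E →L[ℝ] ℝ) (A : E →L[ℝ] E)
    {ζ : E} (hζ : A ζ = 0) (hη : η ζ = 1) (K : Submodule ℝ E)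
    (hK : ∀ v, v ∈ K ↔ η v = 0 ∧ A v = 0) :
    Module.finrank ℝ (E ⧸ K) = Module.finrank ℝ (LinearMap.range A.toLinearMap) + 1 := by
  let L : E →ₗ[ℝ] LinearMap.range A.toLinearMap × ℝ :=
    A.toLinearMap.rangeRestrict.prod η.toLinearMap
  have hker : LinearMap.ker L = K := by
    ext v
    rw [hK, LinearMap.mem_ker, LinearMap.prod_apply, Prod.ext_iff, and_comm]
    refine and_congr Iff.rfl ?_
    exact ⟨fun h => congrArg Subtype.val h, fun h => Subtype.ext h⟩
  have hsurj : Function.Surjective L := by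
    rintro ⟨⟨_, v, rfl⟩, c⟩
    refine ⟨v + (c - η v) • ζ, Prod.ext (Subtype.ext ?_) ?_⟩
    · change A (v + (c - η v) • ζ) = A v
      simp [hζ]
    · change η (v + (c - η v) • ζ) = c
      simp [hη]
  rw [← hker, (L.quotKerEquivOfSurjective hsurj).finrank_eq, Module.finrank_prod,
    Module.finrank_self]

namespace IsLinearThreeStructure

variable {g : E →L[ℝ] E →L[ℝ] ℝ} {φ : Fin 3 → E →L[ℝ] E} {ξ : Fin 3 → E}
  (h : IsLinearThreeStructure g φ ξ)

include h

/-- If `a = 0`, the rank would be one more than the dimension of the range of `A`. That range is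
invariant under the structure and orthogonal to every `ξ β`, so the rank would be 1 and not 3 modulo
4. -/
theorem eigenvalue_ne_zero [FiniteDimensional ℝ E] {A : E →L[ℝ] E} (hA : IsCommutingSymm g φ A)
    {a : ℝ} (ha : ∀ α, A (ξ α) = a • ξ α) {α : Fin 3} {K : Submodule ℝ E}
    (hK : ∀ v, v ∈ K ↔ g (ξ α) v = 0 ∧ A v = 0) {l : ℕ}
    (hl : Module.finrank ℝ (E ⧸ K) = 4 * l + 3) : a ≠ 0 := by
  rintro rfl
  have hξ : ∀ α, A (ξ α) = 0 := fun α => by rw [ha, zero_smul]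
  rw [finrank_quotient_ker_inf_ker (g (ξ α)) A (hξ α) (h.contactMetric α).unit K hK] at hl
  obtain ⟨m, hm⟩ := h.four_dvd_finrank_of_invariant (LinearMap.range A.toLinearMap)
    (by rintro β _ ⟨v, rfl⟩; exact ⟨φ β v, (hA.comm β v).symm⟩)
    (by rintro β _ ⟨v, rfl⟩
        change g (ξ β) (A v) = 0
        rw [← hA.symm, hξ, map_zero, zero_apply])
  omega

end IsLinearThreeStructure

end ThreeStructure

/-! ### Positivity of exterior powers on hyperbolic systems -/

section WedgePositivity

variable {V : Type*} [AddCommGroup V] [Module ℝ V]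

theorem wedge_apply {p q : ℕ} (a : V [⋀^Fin p]→ₗ[ℝ] ℝ) (b : V [⋀^Fin q]→ₗ[ℝ] ℝ)
    (v : Fin (p + q) → V) :
    wedge a b v = ∑ σ : Equiv.Perm.ModSumCongr (Fin p) (Fin q),
      LinearMap.mul' ℝ ℝ (AlternatingMap.domCoprod.summand a b σ (v ∘ finSumFinEquiv)) := by
  rw [← map_sum]
  simp only [wedge, AlternatingMap.domDomCongr_apply, LinearMap.compAlternatingMap_apply,
    AlternatingMap.domCoprod_apply]
  congr 1
  exact sum_apply _ _ _

theorem mul'_summand_mk {p q : ℕ} (a : V [⋀^Fin p]→ₗ[ℝ] ℝ) (b : V [⋀^Fin q]→ₗ[ℝ] ℝ)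
    (σ : Equiv.Perm (Fin p ⊕ Fin q)) (u : Fin p ⊕ Fin q → V) :
    LinearMap.mul' ℝ ℝ (AlternatingMap.domCoprod.summand a b (Quotient.mk'' σ) u) =
      ((Equiv.Perm.sign σ : ℤ) : ℝ) *
        ((a fun i => u (σ (Sum.inl i))) * b fun i => u (σ (Sum.inr i))) := by
  rw [AlternatingMap.domCoprod.summand_mk'', smul_apply]
  rcases Int.units_eq_one_or (Equiv.Perm.sign σ) with h | h <;> simp [h]

/-- An exterior product is positive on vectors for which no term of the shuffle sum is negative and
the leading one is positive. -/
theorem wedge_pos {p q : ℕ} (a : V [⋀^Fin p]→ₗ[ℝ] ℝ) (b : V [⋀^Fin q]→ₗ[ℝ] ℝ)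
    (v : Fin (p + q) → V) (u : Fin p ⊕ Fin q → V) (hu : v ∘ finSumFinEquiv = u)
    (hnonneg : ∀ σ : Equiv.Perm (Fin p ⊕ Fin q), 0 ≤ ((Equiv.Perm.sign σ : ℤ) : ℝ) *
        ((a fun i => u (σ (Sum.inl i))) * b fun i => u (σ (Sum.inr i))))
    (hpos : 0 < (a fun i => u (Sum.inl i)) * b fun i => u (Sum.inr i)) : 0 < wedge a b v := by
  rw [wedge_apply, hu]
  refine Finset.sum_pos' (fun σ _ => ?_) ⟨Quotient.mk'' 1, Finset.mem_univ _, ?_⟩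
  · induction σ using Quotient.inductionOn' with
    | h σ => rw [mul'_summand_mk]; exact hnonneg σ
  · rw [mul'_summand_mk]; simpa using hpos

/-- A permutation preserving the blocks represents the same shuffle class as the identity, and the
signed term depends only on the class. -/
theorem shuffle_term_of_mapsTo {p q : ℕ} (a : V [⋀^Fin p]→ₗ[ℝ] ℝ) (b : V [⋀^Fin q]→ₗ[ℝ] ℝ)
    (u : Fin p ⊕ Fin q → V) (σ : Equiv.Perm (Fin p ⊕ Fin q))
    (hσ : MapsTo σ (range Sum.inl) (range Sum.inl)) :
    ((Equiv.Perm.sign σ : ℤ) : ℝ) *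
        ((a fun i => u (σ (Sum.inl i))) * b fun i => u (σ (Sum.inr i))) =
      (a fun i => u (Sum.inl i)) * b fun i => u (Sum.inr i) := by
  obtain ⟨⟨s, t⟩, rfl⟩ := Equiv.Perm.mem_sumCongrHom_range_of_perm_mapsTo_inl hσ
  rw [← mul'_summand_mk]
  have h1 : (Quotient.mk'' (Equiv.Perm.sumCongrHom (Fin p) (Fin q) (s, t)) :
      Equiv.Perm.ModSumCongr (Fin p) (Fin q)) = Quotient.mk'' 1 := by
    refine Quotient.sound' ?_
    rw [QuotientGroup.leftRel_apply, mul_one, Subgroup.inv_mem_iff]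
    exact ⟨_, rfl⟩
  rw [h1, mul'_summand_mk]
  simp

theorem mapsTo_inl_of_mapsTo_inr {p q : ℕ} (σ : Equiv.Perm (Fin p ⊕ Fin q))
    (hσ : ∀ j, ∃ k, σ (Sum.inr j) = Sum.inr k) :
    MapsTo σ (range Sum.inl) (range Sum.inl) := by
  choose f hf using hσ
  have hinj : Function.Injective f := fun i j hij =>
    Sum.inr_injective (σ.injective (by rw [hf, hf, hij]))
  have hsurj := Finite.injective_iff_surjective.1 hinj
  rintro _ ⟨i, rfl⟩
  rcases h : σ (Sum.inl i) with j | j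
  · exact ⟨j, rfl⟩
  · obtain ⟨k, rfl⟩ := hsurj j
    exact absurd (σ.injective (h.trans (hf k).symm)) Sum.inl_ne_inr

/-- The sequence `e 0, f 0, e 1, f 1, …`. -/
def interleave (e f : ℕ → V) (i : ℕ) : V := if i % 2 = 0 then e (i / 2) else f (i / 2)

/-- `e 0, f 0, …, e (n - 1), f (n - 1)` are hyperbolic pairs, orthogonal to each other. -/
structure IsHyperbolic (θ : V [⋀^Fin 2]→ₗ[ℝ] ℝ) (n : ℕ) (e f : ℕ → V) : Prop where
  pos : ∀ i < n, 0 < θ ![e i, f i]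
  orthogonal : ∀ i < n, ∀ j < n, i ≠ j → θ ![e i, e j] = 0 ∧ θ ![e i, f j] = 0 ∧
    θ ![f i, e j] = 0 ∧ θ ![f i, f j] = 0

theorem IsHyperbolic.interleave_eq_zero {θ : V [⋀^Fin 2]→ₗ[ℝ] ℝ} {n : ℕ} {e f : ℕ → V}
    (h : IsHyperbolic θ n e f) {i j : ℕ} (hi : i < 2 * n) (hj : j < 2 * n) (hij : i / 2 ≠ j / 2) :
    θ ![interleave e f i, interleave e f j] = 0 := by
  obtain ⟨h1, h2, h3, h4⟩ := h.orthogonal (i / 2) (by omega) (j / 2) (by omega) hij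
  unfold interleave
  split_ifs <;> assumption

theorem IsHyperbolic.comp {θ : V [⋀^Fin 2]→ₗ[ℝ] ℝ} {n : ℕ} {e f : ℕ → V}
    (h : IsHyperbolic θ n e f) (s : Equiv.Perm ℕ) (hs : ∀ i < n, s i < n) :
    IsHyperbolic θ n (e ∘ s) (f ∘ s) where
  pos i hi := h.pos _ (hs i hi)
  orthogonal i hi j hj hij := h.orthogonal _ (hs i hi) _ (hs j hj) (s.injective.ne hij)

theorem IsHyperbolic.mono {θ : V [⋀^Fin 2]→ₗ[ℝ] ℝ} {n m : ℕ} {e f : ℕ → V}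
    (h : IsHyperbolic θ n e f) (hm : m ≤ n) : IsHyperbolic θ m e f where
  pos i hi := h.pos i (hi.trans_le hm)
  orthogonal i hi j hj hij := h.orthogonal i (hi.trans_le hm) j (hj.trans_le hm) hij

/-- Induction on the number of pairs. A shuffle that feeds the last factor `θ` two vectors from
different pairs contributes zero. If they come from one pair, the term is the leading term of a
system with two pairs interchanged, hence positive, because interchanging pairs is an even
permutation. -/
theorem wedgePow_pos (θ : V [⋀^Fin 2]→ₗ[ℝ] ℝ) : ∀ (n : ℕ) (e f : ℕ → V), IsHyperbolic θ n e f →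
    0 < wedgePow θ n fun i : Fin (2 * n) => interleave e f i
  | 0, _, _, _ => by simp [wedgePow]
  | n + 1, e, f, h => by
    let w : (ℕ → V) → (ℕ → V) → Fin (2 * n) ⊕ Fin 2 → V := fun e f =>
      Sum.elim (fun i => interleave e f i) (fun i => interleave e f (2 * n + i))
    have hw0 : ∀ e f, w e f (Sum.inr 0) = e n := fun e f => by
      simp [w, interleave]
    have hw1 : ∀ e f, w e f (Sum.inr 1) = f n := fun e f => by
      simp [w, interleave, Nat.add_mod]
      congr 1
      omega
    have hθ : ∀ e f, IsHyperbolic θ (n + 1) e f →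
        0 < (wedgePow θ n fun i => w e f (Sum.inl i)) * θ fun i => w e f (Sum.inr i) :=
      fun e f h => by
      refine mul_pos (wedgePow_pos θ n e f (h.mono n.le_succ)) ?_
      have h1 : (fun i => w e f (Sum.inr i)) = ![e n, f n] := by
        ext i; fin_cases i
        · exact hw0 e f
        · exact hw1 e f
      rw [h1]
      exact h.pos n n.lt_succ_self
    refine wedge_pos (wedgePow θ n) θ _ (w e f) ?_ (fun σ => ?_) (hθ e f h)
    · ext x
      rcases x with i | i <;> simp [w]
    let ix : Fin (2 * n) ⊕ Fin 2 → ℕ := fun x => finSumFinEquiv x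
    have hix : ∀ x, ix x < 2 * (n + 1) := fun x => (finSumFinEquiv x).2
    have hix_inj : ∀ x y, ix x = ix y → x = y := fun x y hxy =>
      finSumFinEquiv.injective (Fin.ext hxy)
    have hwix : ∀ e f x, w e f x = interleave e f (ix x) := fun e f x => by
      rcases x with i | i <;> simp [w, ix]
    by_cases hne : ix (σ (Sum.inr 0)) / 2 ≠ ix (σ (Sum.inr 1)) / 2
    · have h1 : (fun i => w e f (σ (Sum.inr i))) =
          ![interleave e f (ix (σ (Sum.inr 0))), interleave e f (ix (σ (Sum.inr 1)))] := by
        ext i; fin_cases i <;> exact hwix _ _ _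
      rw [h1, h.interleave_eq_zero (hix _) (hix _) hne]
      simp
    rw [not_not] at hne
    have hne' : ix (σ (Sum.inr 0)) ≠ ix (σ (Sum.inr 1)) := fun h' => by
      simpa using σ.injective (hix_inj _ _ h')
    set k := ix (σ (Sum.inr 0)) / 2 with hk
    have hk0 := hix (σ (Sum.inr 0))
    have hk1 := hix (σ (Sum.inr 1))
    rcases (show k ≤ n by omega).eq_or_lt with hkn | hkn
    -- The last factor receives the last pair, so the permutation preserves the blocks.
    · rw [shuffle_term_of_mapsTo]
      · exact (hθ e f h).le
      refine mapsTo_inl_of_mapsTo_inr σ fun j => ?_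
      have h2 : 2 * n ≤ ix (σ (Sum.inr j)) := by
        fin_cases j <;> simp only [Fin.zero_eta, Fin.mk_one] <;> omega
      rcases h3 : σ (Sum.inr j) with i | i
      · rw [h3] at h2
        simp [ix] at h2
        omega
      · exact ⟨i, rfl⟩
    -- The last factor receives pair `k < n`. The even involution `ρ` exchanges pairs `k` and `n`,
    -- after which `ρ * σ` preserves the blocks.
    · let x0 : Fin (2 * n) ⊕ Fin 2 := Sum.inl ⟨2 * k, by omega⟩
      let x1 : Fin (2 * n) ⊕ Fin 2 := Sum.inl ⟨2 * k + 1, by omega⟩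
      have hx01 : x0 ≠ x1 := by simp [x0, x1]
      have hx0 : ∀ i, x0 ≠ Sum.inr i := fun i => by simp [x0]
      have hx1 : ∀ i, x1 ≠ Sum.inr i := fun i => by simp [x1]
      let ρ : Equiv.Perm (Fin (2 * n) ⊕ Fin 2) :=
        Equiv.swap x0 (Sum.inr 0) * Equiv.swap x1 (Sum.inr 1)
      have hsign : Equiv.Perm.sign ρ = 1 := by
        rw [Equiv.Perm.sign_mul, Equiv.Perm.sign_swap (hx0 _), Equiv.Perm.sign_swap (hx1 _)]
        rfl
      have r0 : ρ x0 = Sum.inr 0 := by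
        simp only [ρ, Equiv.Perm.mul_apply]
        rw [Equiv.swap_apply_of_ne_of_ne hx01 (hx0 _), Equiv.swap_apply_left]
      have r1 : ρ x1 = Sum.inr 1 := by
        simp only [ρ, Equiv.Perm.mul_apply]
        rw [Equiv.swap_apply_left, Equiv.swap_apply_of_ne_of_ne (hx0 _).symm (by simp)]
      have r2 : ρ (Sum.inr 0) = x0 := by
        simp only [ρ, Equiv.Perm.mul_apply]
        rw [Equiv.swap_apply_of_ne_of_ne (hx1 _).symm (by simp), Equiv.swap_apply_right]
      have r3 : ρ (Sum.inr 1) = x1 := by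
        simp only [ρ, Equiv.Perm.mul_apply]
        rw [Equiv.swap_apply_right, Equiv.swap_apply_of_ne_of_ne hx01.symm (hx1 _)]
      have r4 : ∀ x, x ≠ x0 → x ≠ x1 → x ≠ Sum.inr 0 → x ≠ Sum.inr 1 → ρ x = x :=
        fun x h0 h1 h2 h3 => by
        simp only [ρ, Equiv.Perm.mul_apply]
        rw [Equiv.swap_apply_of_ne_of_ne h1 h3, Equiv.swap_apply_of_ne_of_ne h0 h2]
      have hinv : ∀ x, ρ (ρ x) = x := fun x => by
        by_cases h0 : x = x0
        · rw [h0, r0, r2]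
        by_cases h1 : x = x1
        · rw [h1, r1, r3]
        by_cases h2 : x = Sum.inr 0
        · rw [h2, r2, r0]
        by_cases h3 : x = Sum.inr 1
        · rw [h3, r3, r1]
        rw [r4 x h0 h1 h2 h3, r4 x h0 h1 h2 h3]
      let s := Equiv.swap k n
      have hx0v : ∀ e f : ℕ → V, w e f x0 = e k := fun e f => by simp [w, x0, interleave]
      have hx1v : ∀ e f : ℕ → V, w e f x1 = f k := fun e f => by
        simp [w, x1, interleave, Nat.add_mod]
        congr 1
        omega
      have hwρ : ∀ x, w e f (ρ x) = w (e ∘ s) (f ∘ s) x := fun x => by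
        by_cases h0 : x = x0
        · rw [h0, r0, hw0, hx0v]; simp [s]
        by_cases h1 : x = x1
        · rw [h1, r1, hw1, hx1v]; simp [s]
        by_cases h2 : x = Sum.inr 0
        · rw [h2, r2, hw0, hx0v]; simp [s]
        by_cases h3 : x = Sum.inr 1
        · rw [h3, r3, hw1, hx1v]; simp [s]
        rw [r4 x h0 h1 h2 h3, hwix, hwix]
        have hxk : ix x / 2 ≠ k := fun h' => by
          rcases (show ix x = ix x0 ∨ ix x = ix x1 by simp [ix, x0, x1] at h' ⊢; omega) with h' | h'
          · exact h0 (hix_inj _ _ h')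
          · exact h1 (hix_inj _ _ h')
        have hxn : ix x / 2 ≠ n := fun h' => by
          rcases (show ix x = ix (Sum.inr 0) ∨ ix x = ix (Sum.inr 1) by
            simp [ix] at h' ⊢; omega) with h' | h'
          · exact h2 (hix_inj _ _ h')
          · exact h3 (hix_inj _ _ h')
        simp only [interleave, Function.comp_apply, s, Equiv.swap_apply_of_ne_of_ne hxk hxn]
      have h2 := shuffle_term_of_mapsTo (wedgePow θ n) θ (w (e ∘ s) (f ∘ s)) (ρ * σ)
        (mapsTo_inl_of_mapsTo_inr _ fun j => ?_)
      · have h3 : ∀ x, w (e ∘ s) (f ∘ s) ((ρ * σ) x) = w e f (σ x) := fun x => by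
          rw [← hwρ, Equiv.Perm.mul_apply ρ σ, hinv]
        simp only [h3, map_mul, hsign, one_mul] at h2
        rw [h2]
        refine (hθ _ _ (h.comp s fun i hi => ?_)).le
        simp only [s, Equiv.swap_apply_def]
        split_ifs <;> omega
      · have h3 : σ (Sum.inr j) = x0 ∨ σ (Sum.inr j) = x1 := by
          have : ix (σ (Sum.inr j)) = ix x0 ∨ ix (σ (Sum.inr j)) = ix x1 := by
            have e0 : ix x0 = 2 * k := by simp [ix, x0]
            have e1 : ix x1 = 2 * k + 1 := by simp [ix, x1]
            rw [e0, e1]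
            fin_cases j <;> simp only [Fin.zero_eta, Fin.mk_one] <;> omega
          exact this.imp (hix_inj _ _) (hix_inj _ _)
        rw [Equiv.Perm.mul_apply]
        rcases h3 with h3 | h3 <;> rw [h3]
        · exact ⟨0, r0⟩
        · exact ⟨1, r1⟩

/-- The exterior product of a 1-form with a power of a 2-form is nonzero, if the 1-form is positive
on some vector and there are hyperbolic pairs in its kernel. -/
theorem wedge_wedgePow_ne_zero (a : V [⋀^Fin 1]→ₗ[ℝ] ℝ) (θ : V [⋀^Fin 2]→ₗ[ℝ] ℝ) (n : ℕ)
    (e f : ℕ → V) (h : IsHyperbolic θ n e f) (ζ : V) (hζ : 0 < a fun _ => ζ)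
    (he : ∀ i < n, a (fun _ => e i) = 0) (hf : ∀ i < n, a (fun _ => f i) = 0) :
    wedge a (wedgePow θ n) ≠ 0 := by
  let u : Fin 1 ⊕ Fin (2 * n) → V := Sum.elim (fun _ => ζ) fun i => interleave e f i
  have hpos : 0 < (a fun i => u (Sum.inl i)) * wedgePow θ n fun i => u (Sum.inr i) :=
    mul_pos hζ (wedgePow_pos θ n e f h)
  have h1 : 0 < wedge a (wedgePow θ n) (u ∘ finSumFinEquiv.symm) := by
    refine wedge_pos a _ _ u (by ext x; simp) (fun σ => ?_) hpos
    -- The 1-form receives either `ζ`, which gives the leading term, or a vector of its kernel.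
    rcases hσ : σ (Sum.inl 0) with i | i
    · rw [shuffle_term_of_mapsTo]
      · exact hpos.le
      · rintro _ ⟨j, rfl⟩
        rw [Subsingleton.elim j 0, hσ]
        exact ⟨i, rfl⟩
    · have h2 : (a fun j => u (σ (Sum.inl j))) = 0 := by
        have h3 : (fun j => u (σ (Sum.inl j))) = fun _ : Fin 1 => interleave e f i := by
          ext j
          rw [Subsingleton.elim j 0, hσ]
          rfl
        rw [h3]
        unfold interleave
        split_ifs
        · exact he _ (by omega)
        · exact hf _ (by omega)
      rw [h2]
      simp
  intro h0
  rw [h0] at h1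
  exact lt_irrefl _ h1

end WedgePositivity

/-! ### The volume form of a contact metric structure on a vector space -/

section ContactVolume

variable {E : Type*} [NormedAddCommGroup E] [NormedSpace ℝ E] [FiniteDimensional ℝ E]
  {g : E →L[ℝ] E →L[ℝ] ℝ} {φ : E →L[ℝ] E} {ξ : E}

/-- A unitary-type system: `n` nonzero vectors in `ker η`, orthogonal to each other and to each
other's images under `φ`. -/
theorem IsLinearContactMetric.exists_orthogonal_system (h : IsLinearContactMetric g φ ξ) {n : ℕ}
    (hn : Module.finrank ℝ E = 2 * n + 1) : ∀ m ≤ n, ∃ e : ℕ → E,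
      (∀ i < m, e i ≠ 0 ∧ g ξ (e i) = 0) ∧
      ∀ i < m, ∀ j < m, i ≠ j → g (e i) (e j) = 0 ∧ g (e i) (φ (e j)) = 0
  | 0, _ => ⟨0, by simp, by simp⟩
  | m + 1, hm => by
    obtain ⟨e, he, ho⟩ := h.exists_orthogonal_system hn m (by omega)
    let L : E →ₗ[ℝ] ℝ × (Fin m → ℝ × ℝ) := (g ξ).toLinearMap.prod
      (LinearMap.pi fun i => (g (e i)).toLinearMap.prod (g (φ (e i))).toLinearMap)
    -- There are `2 * m + 1` linear conditions on a space of dimension `2 * n + 1`, and `m < n`.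
    have hL : LinearMap.ker L ≠ ⊥ := LinearMap.ker_ne_bot_of_finrank_lt (by
      rw [Module.finrank_prod, Module.finrank_pi_fintype, hn]
      simp
      omega)
    obtain ⟨v, hv, hv0⟩ := (Submodule.ne_bot_iff _).1 hL
    have hv1 : g ξ v = 0 := congrArg Prod.fst hv
    have hv2 : ∀ i < m, g (e i) v = 0 := fun i hi =>
      congrArg (fun z => (z.2 ⟨i, hi⟩).1) hv
    have hv3 : ∀ i < m, g (φ (e i)) v = 0 := fun i hi =>
      congrArg (fun z => (z.2 ⟨i, hi⟩).2) hv
    have hm' : ∀ i < m, Function.update e m v i = e i := fun i hi =>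
      Function.update_of_ne hi.ne _ _
    refine ⟨Function.update e m v, fun i hi => ?_, fun i hi j hj hij => ?_⟩
    · rcases Nat.lt_succ_iff_lt_or_eq.1 hi with hi | rfl
      · rw [hm' i hi]; exact he i hi
      · rw [Function.update_self]; exact ⟨hv0, hv1⟩
    · rcases Nat.lt_succ_iff_lt_or_eq.1 hi with hi | rfl <;>
        rcases Nat.lt_succ_iff_lt_or_eq.1 hj with hj | rfl
      · rw [hm' i hi, hm' j hj]; exact ho i hi j hj hij
      · rw [hm' i hi, Function.update_self]
        exact ⟨hv2 i hi, by rw [← neg_eq_zero, ← h.skew, hv3 i hi]⟩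
      · rw [hm' j hj, Function.update_self]
        exact ⟨by rw [h.symm, hv2 j hj], by rw [h.symm, hv3 j hj]⟩
      · exact absurd rfl hij

theorem IsLinearContactMetric.wedge_ne_zero (h : IsLinearContactMetric g φ ξ) {n : ℕ}
    (hn : Module.finrank ℝ E = 2 * n + 1) (a : E [⋀^Fin 1]→ₗ[ℝ] ℝ) (θ : E [⋀^Fin 2]→ₗ[ℝ] ℝ)
    (ha : ∀ v, a (fun _ => v) = g ξ v) (hθ : ∀ u v, θ ![u, v] = g u (φ v)) :
    wedge a (wedgePow θ n) ≠ 0 := by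
  obtain ⟨e, he, ho⟩ := h.exists_orthogonal_system hn n le_rfl
  have hsq : ∀ i < n, φ (φ (e i)) = -e i := fun i hi => by
    rw [h.sq, (he i hi).2, zero_smul, add_zero]
  -- The order within a pair fixes the sign: `θ ![φ e, e] = g (φ e) (φ e)` is positive.
  refine wedge_wedgePow_ne_zero a θ n (fun i => φ (e i)) e ⟨fun i hi => ?_, fun i hi j hj hij => ?_⟩
    ξ ?_ (fun i hi => ?_) fun i hi => ?_
  · rw [hθ, h.compatible, (he i hi).2, zero_mul, sub_zero]
    exact h.pos _ (he i hi).1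
  · obtain ⟨h1, h2⟩ := ho i hi j hj hij
    simp only [hθ, hsq j hj, h.compatible, (he i hi).2, h.skew, map_neg, h1, h2]
    simp
  · rw [ha, h.unit]; exact one_pos
  · rw [ha, h.η_map]
  · rw [ha, (he i hi).2]

end ContactVolume

/-! ### Tensor fields in the preferred chart at a point -/

section Chart

variable {E : Type*} [NormedAddCommGroup E] [NormedSpace ℝ E]
  {M : Type*} [TopologicalSpace M] [ChartedSpace E M]

/-- The derivative of the inverse of the preferred chart at `x₀`. -/
def chartD (x₀ : M) (y : E) : E →L[ℝ] E :=
  mfderiv 𝓘(ℝ, E) 𝓘(ℝ, E) (extChartAt 𝓘(ℝ, E) x₀).symm y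

/-- The derivative of the preferred chart at `x₀`, at the point with coordinates `y`. -/
def chartDInv (x₀ : M) (y : E) : E →L[ℝ] E :=
  mfderiv 𝓘(ℝ, E) 𝓘(ℝ, E) (extChartAt 𝓘(ℝ, E) x₀) ((extChartAt 𝓘(ℝ, E) x₀).symm y)

/-- A vector field in the preferred chart at `x₀`. -/
def VField.chart (X : VField E M) (x₀ : M) (y : E) : E :=
  chartDInv x₀ y (X ((extChartAt 𝓘(ℝ, E) x₀).symm y))

/-- A field of endomorphisms in the preferred chart at `x₀`. -/
def EndField.chart (φ : EndField E M) (x₀ : M) (y : E) : E →L[ℝ] E :=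
  chartDInv x₀ y ∘L (show E →L[ℝ] E from φ ((extChartAt 𝓘(ℝ, E) x₀).symm y)) ∘L chartD x₀ y

variable [IsManifold 𝓘(ℝ, E) ∞ M]

/-- A Riemannian metric in the preferred chart at `x₀`. -/
def chartMetric (g : RMetric E M) (x₀ : M) (y : E) : E →L[ℝ] E →L[ℝ] ℝ :=
  ContinuousLinearMap.bilinearComp
    (show E →L[ℝ] E →L[ℝ] ℝ from g.inner ((extChartAt 𝓘(ℝ, E) x₀).symm y))
    (chartD x₀ y) (chartD x₀ y)

theorem chartDInv_chartD {x₀ : M} {y : E} (hy : y ∈ (extChartAt 𝓘(ℝ, E) x₀).target) (v : E) :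
    chartDInv x₀ y (chartD x₀ y v) = v := by
  have h := mfderiv_extChartAt_comp_mfderivWithin_extChartAt_symm (I := 𝓘(ℝ, E)) hy
  rw [ModelWithCorners.range_eq_univ, mfderivWithin_univ] at h
  exact DFunLike.congr_fun h v

theorem chartD_chartDInv {x₀ : M} {y : E} (hy : y ∈ (extChartAt 𝓘(ℝ, E) x₀).target) (v : E) :
    chartD x₀ y (chartDInv x₀ y v) = v := by
  have h := mfderivWithin_extChartAt_symm_comp_mfderiv_extChartAt (I := 𝓘(ℝ, E)) hy
  rw [ModelWithCorners.range_eq_univ, mfderivWithin_univ] at h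
  exact DFunLike.congr_fun h v

/-- The tangent space at `x₀` is identified with `E` by this very chart, so at the base point chart
expressions are the original values. -/
theorem chartD_self (x₀ : M) :
    chartD x₀ (extChartAt 𝓘(ℝ, E) x₀ x₀) = ContinuousLinearMap.id ℝ E := by
  have h := mfderivWithin_range_extChartAt_symm (I := 𝓘(ℝ, E)) (x := x₀)
  rw [ModelWithCorners.range_eq_univ, mfderivWithin_univ] at h
  exact h

theorem chartDInv_self (x₀ : M) :
    chartDInv x₀ (extChartAt 𝓘(ℝ, E) x₀ x₀) = ContinuousLinearMap.id ℝ E := by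
  ext v
  have h := chartDInv_chartD (mem_extChartAt_target (I := 𝓘(ℝ, E)) x₀) v
  rwa [chartD_self] at h

theorem VField.chart_self (X : VField E M) (x₀ : M) :
    X.chart x₀ (extChartAt 𝓘(ℝ, E) x₀ x₀) = X x₀ := by
  have h : ∀ z : M, z = x₀ → (X z : E) = X x₀ := by rintro _ rfl; rfl
  rw [VField.chart, chartDInv_self]
  exact h _ (extChartAt_to_inv (I := 𝓘(ℝ, E)) x₀)

theorem EndField.chart_self (φ : EndField E M) (x₀ : M) (v : E) :
    φ.chart x₀ (extChartAt 𝓘(ℝ, E) x₀ x₀) v = φ x₀ v := by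
  have h : ∀ z : M, z = x₀ → (show E →L[ℝ] E from φ z) = φ x₀ := by rintro _ rfl; rfl
  rw [EndField.chart, chartDInv_self, chartD_self]
  exact DFunLike.congr_fun (h _ (extChartAt_to_inv (I := 𝓘(ℝ, E)) x₀)) v

theorem chartMetric_self (g : RMetric E M) (x₀ : M) (u v : E) :
    chartMetric g x₀ (extChartAt 𝓘(ℝ, E) x₀ x₀) u v = g.inner x₀ u v := by
  have h : ∀ z : M, z = x₀ → (show E →L[ℝ] E →L[ℝ] ℝ from g.inner z) = g.inner x₀ := by
    rintro _ rfl; rfl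
  rw [chartMetric, chartD_self]
  exact DFunLike.congr_fun (DFunLike.congr_fun (h _ (extChartAt_to_inv (I := 𝓘(ℝ, E)) x₀)) u) v

/-- Smooth sections of the tangent bundle over a chart domain are smooth in the chart. -/
theorem VField.contDiffOn_chart {X : VField E M} {x₀ : M}
    (hX : ContMDiffOn 𝓘(ℝ, E) (𝓘(ℝ, E).prod 𝓘(ℝ, E)) ∞
      (fun x => (TotalSpace.mk' E x (X x) : TangentBundle 𝓘(ℝ, E) M)) (chartAt E x₀).source) :
    ContDiffOn ℝ ∞ (X.chart x₀) (extChartAt 𝓘(ℝ, E) x₀).target := by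
  let e := trivializationAt E (TangentSpace 𝓘(ℝ, E) : M → Type _) x₀
  have h1 : ContMDiffOn 𝓘(ℝ, E) 𝓘(ℝ, E) ∞ (fun x => (e ⟨x, X x⟩).2) e.baseSet :=
    (e.contMDiffOn_section_baseSet_iff (IB := 𝓘(ℝ, E)) (n := ∞)).1 hX
  have h2 : ContMDiffOn 𝓘(ℝ, E) 𝓘(ℝ, E) ∞
      (fun y => (e ⟨(extChartAt 𝓘(ℝ, E) x₀).symm y, X ((extChartAt 𝓘(ℝ, E) x₀).symm y)⟩).2)
      (extChartAt 𝓘(ℝ, E) x₀).target := by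
    refine h1.comp (contMDiffOn_extChartAt_symm x₀) fun y hy => ?_
    have := (extChartAt 𝓘(ℝ, E) x₀).map_target hy
    rwa [extChartAt_source] at this
  refine (contMDiffOn_iff_contDiffOn.1 h2).congr fun y hy => ?_
  have hsrc := (extChartAt 𝓘(ℝ, E) x₀).map_target hy
  rw [extChartAt_source] at hsrc
  have h3 := TangentBundle.continuousLinearMapAt_trivializationAt (I := 𝓘(ℝ, E)) hsrc
  have h4 := DFunLike.congr_fun h3 (X ((extChartAt 𝓘(ℝ, E) x₀).symm y))
  refine h4.symm.trans ?_
  rw [Trivialization.continuousLinearMapAt_apply, Trivialization.linearMapAt_apply, if_pos]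
  exact hsrc

/-- The coordinate vector fields of the preferred chart at `x₀`. -/
def coordField (x₀ : M) (u : E) : VField E M :=
  fun x => chartD x₀ (extChartAt 𝓘(ℝ, E) x₀ x) u

theorem contMDiffOn_coordField (x₀ : M) (u : E) :
    ContMDiffOn 𝓘(ℝ, E) (𝓘(ℝ, E).prod 𝓘(ℝ, E)) ∞
      (fun x => (TotalSpace.mk' E x (coordField x₀ u x) : TangentBundle 𝓘(ℝ, E) M))
      (chartAt E x₀).source := by
  let e := trivializationAt E (TangentSpace 𝓘(ℝ, E) : M → Type _) x₀
  refine (e.contMDiffOn_section_baseSet_iff (IB := 𝓘(ℝ, E)) (n := ∞)).2 ?_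
  refine (contMDiffOn_const (c := u)).congr fun x hx => ?_
  have hx' : x ∈ (chartAt E x₀).source := hx
  have h1 := DFunLike.congr_fun (TangentBundle.symmL_trivializationAt (I := 𝓘(ℝ, E)) hx') u
  rw [ModelWithCorners.range_eq_univ, mfderivWithin_univ] at h1
  have h2 : coordField x₀ u x = e.symmL ℝ x u := h1.symm
  rw [h2]
  have := e.continuousLinearMapAt_symmL (R := ℝ) hx u
  rw [Trivialization.continuousLinearMapAt_apply, Trivialization.linearMapAt_apply, if_pos hx]
    at this
  exact this

omit [IsManifold 𝓘(ℝ, E) ∞ M] in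
theorem coordField_symm {x₀ : M} {y : E} (hy : y ∈ (extChartAt 𝓘(ℝ, E) x₀).target) (u : E) :
    coordField x₀ u ((extChartAt 𝓘(ℝ, E) x₀).symm y) = chartD x₀ y u := by
  rw [coordField, (extChartAt 𝓘(ℝ, E) x₀).right_inv hy]

theorem EndField.contMDiffOn_apply {φ : EndField E M} (hφ : φ.IsSmooth) {X : VField E M}
    {s : Set M} (hX : ContMDiffOn 𝓘(ℝ, E) (𝓘(ℝ, E).prod 𝓘(ℝ, E)) ∞
      (fun x => (TotalSpace.mk' E x (X x) : TangentBundle 𝓘(ℝ, E) M)) s) :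
    ContMDiffOn 𝓘(ℝ, E) (𝓘(ℝ, E).prod 𝓘(ℝ, E)) ∞
      (fun x => (TotalSpace.mk' E x (φ x (X x)) : TangentBundle 𝓘(ℝ, E) M)) s :=
  ContMDiffOn.clm_bundle_apply (b := fun x : M => x) (ContMDiff.contMDiffOn hφ) hX

/-- In finite dimension smoothness of an operator-valued map can be tested on fixed vectors, which
correspond to coordinate fields. -/
theorem EndField.contDiffOn_chart [FiniteDimensional ℝ E] {φ : EndField E M} (hφ : φ.IsSmooth)
    (x₀ : M) : ContDiffOn ℝ ∞ (φ.chart x₀) (extChartAt 𝓘(ℝ, E) x₀).target := by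
  refine contDiffOn_clm_apply.2 fun u => ?_
  refine (VField.contDiffOn_chart (EndField.contMDiffOn_apply hφ
    (contMDiffOn_coordField x₀ u))).congr fun y hy => ?_
  rw [VField.chart, coordField_symm hy]
  rfl

theorem contDiffOn_chartMetric [FiniteDimensional ℝ E] (g : RMetric E M) (x₀ : M) :
    ContDiffOn ℝ ∞ (chartMetric g x₀) (extChartAt 𝓘(ℝ, E) x₀).target := by
  refine contDiffOn_clm_apply.2 fun u => contDiffOn_clm_apply.2 fun v => ?_
  have h1 := ContMDiffOn.clm_bundle_apply₂ (b := fun x : M => x) (E₃ := Bundle.Trivial M ℝ)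
    (F₃ := ℝ) (IM := 𝓘(ℝ, E)) (IB := 𝓘(ℝ, E)) (n := ∞) (ψ := g.inner)
    (ContMDiff.contMDiffOn g.contMDiff) (contMDiffOn_coordField x₀ u) (contMDiffOn_coordField x₀ v)
  have h2 : ContMDiffOn 𝓘(ℝ, E) 𝓘(ℝ, ℝ) ∞
      (fun x => g.inner x (coordField x₀ u x) (coordField x₀ v x)) (chartAt E x₀).source :=
    fun x hx => (contMDiffWithinAt_totalSpace.1 (h1 x hx)).2
  have h3 := h2.comp (contMDiffOn_extChartAt_symm (I := 𝓘(ℝ, E)) (n := ∞) x₀) fun y hy => by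
    have := (extChartAt 𝓘(ℝ, E) x₀).map_target hy
    rwa [extChartAt_source] at this
  refine (contMDiffOn_iff_contDiffOn.1 h3).congr fun y hy => ?_
  rw [Function.comp_apply, coordField_symm hy, coordField_symm hy]
  rfl

omit [IsManifold 𝓘(ℝ, E) ∞ M] in
theorem target_mem_nhds (x₀ : M) :
    (extChartAt 𝓘(ℝ, E) x₀).target ∈ 𝓝 (extChartAt 𝓘(ℝ, E) x₀ x₀) :=
  extChartAt_target_mem_nhds x₀

theorem VField.IsSmooth.differentiableAt_chart {X : VField E M} (hX : X.IsSmooth) (x₀ : M) :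
    DifferentiableAt ℝ (X.chart x₀) (extChartAt 𝓘(ℝ, E) x₀ x₀) :=
  ((VField.contDiffOn_chart (ContMDiff.contMDiffOn hX)).contDiffAt
    (target_mem_nhds x₀)).differentiableAt (by simp)

theorem EndField.IsSmooth.differentiableAt_chart [FiniteDimensional ℝ E] {φ : EndField E M}
    (hφ : φ.IsSmooth) (x₀ : M) :
    DifferentiableAt ℝ (φ.chart x₀) (extChartAt 𝓘(ℝ, E) x₀ x₀) :=
  ((EndField.contDiffOn_chart hφ x₀).contDiffAt (target_mem_nhds x₀)).differentiableAt (by simp)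

theorem differentiableAt_chartMetric [FiniteDimensional ℝ E] (g : RMetric E M) (x₀ : M) :
    DifferentiableAt ℝ (chartMetric g x₀) (extChartAt 𝓘(ℝ, E) x₀ x₀) :=
  ((contDiffOn_chartMetric g x₀).contDiffAt (target_mem_nhds x₀)).differentiableAt (by simp)

omit [IsManifold 𝓘(ℝ, E) ∞ M] in
theorem DForm.IsSmooth.differentiableAt_inChart {k : ℕ} {θ : DForm E M k} (hθ : θ.IsSmooth)
    (x₀ : M) : DifferentiableAt ℝ (θ.inChart x₀) (extChartAt 𝓘(ℝ, E) x₀ x₀) :=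
  ((hθ x₀).contDiffAt (target_mem_nhds x₀)).differentiableAt (by simp)

/-- Every tangent vector extends to a smooth vector field. -/
theorem exists_smooth_vField [FiniteDimensional ℝ E] [T2Space M] (x₀ : M) (u : E) :
    ∃ X : VField E M, X.IsSmooth ∧ X x₀ = u := by
  let f : SmoothBumpFunction 𝓘(ℝ, E) x₀ := Nonempty.some inferInstance
  refine ⟨fun x => f x • coordField x₀ u x, ?_, ?_⟩
  · exact ContMDiffOn.smul_section_of_tsupport (f.contMDiff.contMDiffOn)
      (chartAt E x₀).open_source f.tsupport_subset_chartAt_source (contMDiffOn_coordField x₀ u)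
  · simp only [f.eq_one, coordField, chartD_self]
    exact one_smul ℝ u

theorem mlieBracket_eq (X Y : VField E M) (x₀ : M) :
    mlieBracket 𝓘(ℝ, E) X Y x₀ =
      lieBracket ℝ (X.chart x₀) (Y.chart x₀) (extChartAt 𝓘(ℝ, E) x₀ x₀) := by
  let V : VField E M → E → E := fun X =>
    mpullbackWithin 𝓘(ℝ, E) 𝓘(ℝ, E) (extChartAt 𝓘(ℝ, E) x₀).symm X (range 𝓘(ℝ, E))
  have key : ∀ X, V X =ᶠ[𝓝 (extChartAt 𝓘(ℝ, E) x₀ x₀)] X.chart x₀ := fun X => by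
    filter_upwards [target_mem_nhds x₀] with y hy
    simp only [V]
    rw [mpullbackWithin_apply, ContinuousLinearMap.inverse_eq
      (mfderivWithin_extChartAt_symm_comp_mfderiv_extChartAt hy)
      (mfderiv_extChartAt_comp_mfderivWithin_extChartAt_symm hy)]
    rfl
  let L : E →L[ℝ] E := mfderiv 𝓘(ℝ, E) 𝓘(ℝ, E) (extChartAt 𝓘(ℝ, E) x₀) x₀
  have hL : L = ContinuousLinearMap.id ℝ E := mfderiv_extChartAt_self (I := 𝓘(ℝ, E)) (x := x₀)
  change L.inverse (lieBracketWithin ℝ (V X) (V Y)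
    ((extChartAt 𝓘(ℝ, E) x₀).symm ⁻¹' univ ∩ range 𝓘(ℝ, E)) (extChartAt 𝓘(ℝ, E) x₀ x₀)) = _
  rw [hL, preimage_univ, univ_inter, ModelWithCorners.range_eq_univ, lieBracketWithin_univ,
    (key X).lieBracket_vectorField_eq (key Y), ContinuousLinearMap.inverse_id]
  rfl

theorem DForm.d_apply {k : ℕ} (θ : DForm E M k) (x₀ : M) (v : Fin (k + 1) → E) :
    θ.d x₀ v = extDeriv (θ.inChart x₀) (extChartAt 𝓘(ℝ, E) x₀ x₀) v := by
  rw [DForm.d, mfderiv_extChartAt_self]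
  rfl

end Chart

/-! ### Existence of a torsion-free metric connection at a point -/

section Christoffel

set_option synthInstance.maxHeartbeats 200000

variable {E : Type*} [NormedAddCommGroup E] [NormedSpace ℝ E] [FiniteDimensional ℝ E]

/-- The Christoffel symbols of a metric with first derivative `G'` at a point. -/
theorem exists_christoffel {g : E →L[ℝ] E →L[ℝ] ℝ} (hsymm : ∀ u v, g u v = g v u)
    (hpos : ∀ v, v ≠ 0 → 0 < g v v) {G' : E →L[ℝ] E →L[ℝ] E →L[ℝ] ℝ}
    (hG' : ∀ u v w, G' u v w = G' u w v) :
    ∃ Γ : E → E →L[ℝ] E, (∀ u v, Γ u v = Γ v u) ∧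
      ∀ u v w, G' u v w = g (Γ u v) w + g v (Γ u w) := by
  let b : LinearMap.BilinForm ℝ E := LinearMap.mk₂ ℝ (fun u v => g u v) (by simp) (by simp)
    (by simp) (by simp)
  have hb : b.Nondegenerate := by
    refine ⟨fun u hu => ?_, fun u hu => ?_⟩ <;>
    · by_contra h0
      exact (hpos u h0).ne' (hu u)
  -- The Koszul formula for coordinate fields, whose brackets vanish.
  let K : E → E →ₗ[ℝ] Module.Dual ℝ E := fun u =>
    LinearMap.mk₂ ℝ (fun v w => (1 / 2 : ℝ) * (G' u v w + G' v u w - G' w u v))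
      (fun v v' w => by simp; ring) (fun c v w => by simp; ring)
      (fun v w w' => by simp; ring) (fun c v w => by simp; ring)
  let Γ : E → E →L[ℝ] E := fun u =>
    LinearMap.toContinuousLinearMap ((b.toDual hb).symm.toLinearMap ∘ₗ K u)
  have hΓ : ∀ u v w, g (Γ u v) w = (1 / 2 : ℝ) * (G' u v w + G' v u w - G' w u v) :=
    fun u v w => by
    have h1 : b.toDual hb ((b.toDual hb).symm (K u v)) w = K u v w := by
      rw [LinearEquiv.apply_symm_apply]
    exact h1
  refine ⟨Γ, fun u v => ?_, fun u v w => ?_⟩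
  · have h1 : ∀ w, g (Γ u v - Γ v u) w = 0 := fun w => by
      rw [map_sub, sub_apply, hΓ, hΓ, hG' w u v]
      ring
    by_contra h0
    exact (hpos _ (sub_ne_zero.2 h0)).ne' (h1 _)
  · rw [hsymm v, hΓ, hΓ, hG' u w v, hG' v u w, hG' w u v]
    ring

end Christoffel

/-! ### From first derivatives to covariant derivatives -/

section Jet

set_option synthInstance.maxHeartbeats 200000

variable {E : Type*} [NormedAddCommGroup E] [NormedSpace ℝ E]
  {G : E → E →L[ℝ] E →L[ℝ] ℝ} {F : E → E →L[ℝ] E} {Z : E → E} {y₀ : E}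
  {G' : E →L[ℝ] E →L[ℝ] E →L[ℝ] ℝ} {F' : E →L[ℝ] E →L[ℝ] E} {Z' : E →L[ℝ] E}
  {Γ : E → E →L[ℝ] E}

theorem hasFDerivAt_apply_apply (hG : HasFDerivAt G G' y₀) (hZ : HasFDerivAt Z Z' y₀) (v : E) :
    HasFDerivAt (fun y => G y (Z y) v) ((G y₀).flip v ∘L Z' + (G'.flip (Z y₀)).flip v) y₀ := by
  have h := (hG.clm_apply hZ).clm_apply (hasFDerivAt_const v y₀)
  convert! h using 1
  ext u
  simp

theorem fderiv_apply_apply (hG : HasFDerivAt G G' y₀) (hZ : HasFDerivAt Z Z' y₀) (u v : E) :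
    fderiv ℝ (fun y => G y (Z y) v) y₀ u = G (y₀) (Z' u) v + G' u (Z y₀) v := by
  rw [(hasFDerivAt_apply_apply hG hZ v).fderiv]
  simp

theorem fderiv_apply_map (hG : HasFDerivAt G G' y₀) (hF : HasFDerivAt F F' y₀) (u v w : E) :
    fderiv ℝ (fun y => G y v (F y w)) y₀ u = G y₀ v (F' u w) + G' u v (F y₀ w) := by
  have h := (hG.clm_apply (hasFDerivAt_const v y₀)).clm_apply
    (hF.clm_apply (hasFDerivAt_const w y₀))
  rw [h.fderiv]
  simp

/-- The covariant derivative of a field of endomorphisms at a point. -/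
def covEnd (Γ : E → E →L[ℝ] E) (F₀ : E →L[ℝ] E) (F' : E →L[ℝ] E →L[ℝ] E) (u : E) : E →L[ℝ] E :=
  F' u + Γ u ∘L F₀ - F₀ ∘L Γ u

/-- The covariant derivative of a vector field at a point. -/
def covVec (Γ : E → E →L[ℝ] E) (Z₀ : E) (Z' : E →L[ℝ] E) : E →L[ℝ] E := Z' + Γ Z₀

theorem covEnd_apply (F₀ : E →L[ℝ] E) (u v : E) :
    covEnd Γ F₀ F' u v = F' u v + Γ u (F₀ v) - F₀ (Γ u v) := rfl

theorem covVec_apply (hΓ : ∀ u v, Γ u v = Γ v u) (Z₀ u : E) :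
    covVec Γ Z₀ Z' u = Z' u + Γ u Z₀ := by rw [hΓ u]; rfl

/-- The torsion of `φ` may be computed with any torsion-free connection, since symmetric Christoffel
terms cancel. -/
theorem normal_covEnd (hΓ : ∀ u v, Γ u v = Γ v u) (F₀ : E →L[ℝ] E) (u v : E) :
    covEnd Γ F₀ F' (F₀ u) v - covEnd Γ F₀ F' (F₀ v) u + F₀ (covEnd Γ F₀ F' v u)
      - F₀ (covEnd Γ F₀ F' u v) =
    F' (F₀ u) v - F' (F₀ v) u + F₀ (F' v u) - F₀ (F' u v) := by
  simp only [covEnd_apply, map_add, map_sub]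
  rw [hΓ (F₀ v) (F₀ u), hΓ v u, hΓ (F₀ u) v, hΓ (F₀ v) u]
  abel

theorem g_covVec {g : E →L[ℝ] E →L[ℝ] ℝ} (hΓ : ∀ u v, Γ u v = Γ v u)
    (hG' : ∀ u v w, G' u v w = g (Γ u v) w + g v (Γ u w)) (Z₀ u v : E) :
    g (covVec Γ Z₀ Z' u) v - g (covVec Γ Z₀ Z' v) u =
      (g (Z' u) v + G' u Z₀ v) - (g (Z' v) u + G' v Z₀ u) := by
  rw [covVec_apply hΓ, covVec_apply hΓ, hG', hG', hΓ u v]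
  simp only [map_add, add_apply]
  ring

theorem g_covEnd {g : E →L[ℝ] E →L[ℝ] ℝ} {F₀ : E →L[ℝ] E} (hΓ : ∀ u v, Γ u v = Γ v u)
    (hG' : ∀ u v w, G' u v w = g (Γ u v) w + g v (Γ u w))
    (hskew : ∀ u v, g (F₀ u) v = -g u (F₀ v)) (hsymm : ∀ u v, g u v = g v u) (u v w : E) :
    g v (covEnd Γ F₀ F' u w) - g u (covEnd Γ F₀ F' v w) + g u (covEnd Γ F₀ F' w v) =
      (g v (F' u w) + G' u v (F₀ w)) - (g u (F' v w) + G' v u (F₀ w))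
        + (g u (F' w v) + G' w u (F₀ v)) := by
  have h1 : ∀ a b, g a (F₀ b) = -g b (F₀ a) := fun a b => by rw [← hskew, hsymm]
  simp only [covEnd_apply, hG', map_add, map_sub]
  rw [h1 v (Γ u w), h1 u (Γ v w), h1 u (Γ w v), hΓ v u, hΓ w v, hΓ w u, h1 (Γ u w) v,
    hΓ v w]
  ring

/-- The covariant derivatives of an almost contact metric structure whose normality tensor vanishes
and whose fundamental form is closed at a point. -/
theorem isQuasiSasakianJet (hG : HasFDerivAt G G' y₀) (hF : HasFDerivAt F F' y₀)
    (hZ : HasFDerivAt Z Z' y₀) (h : ∀ᶠ y in 𝓝 y₀, IsLinearContactMetric (G y) (F y) (Z y))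
    (hΓ : ∀ u v, Γ u v = Γ v u)
    (hG' : ∀ u v w, G' u v w = G y₀ (Γ u v) w + G y₀ v (Γ u w))
    (hN : ∀ u v, F' (F y₀ u) v - F' (F y₀ v) u + F y₀ (F' v u) - F y₀ (F' u v)
      + ((G y₀ (Z' u) v + G' u (Z y₀) v) - (G y₀ (Z' v) u + G' v (Z y₀) u)) • Z y₀ = 0)
    (hd : ∀ u v w, (G y₀ v (F' u w) + G' u v (F y₀ w)) - (G y₀ u (F' v w) + G' v u (F y₀ w))
        + (G y₀ u (F' w v) + G' w u (F y₀ v)) = 0) :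
    IsQuasiSasakianJet (G y₀) (F y₀) (Z y₀) (covEnd Γ (F y₀) F') (covVec Γ (Z y₀) Z') := by
  have h0 := h.self_of_nhds
  -- This identity and the next three differentiate at `y₀` the algebraic identities that hold in a
  -- neighbourhood.
  have d_sq : ∀ u v, F' u (F y₀ v) + F y₀ (F' u v) =
      (G y₀ (Z' u) v + G' u (Z y₀) v) • Z y₀ + G y₀ (Z y₀) v • Z' u := fun u v => by
    have h1 := hF.clm_apply (hF.clm_apply (hasFDerivAt_const v y₀))
    have h2 := ((hasFDerivAt_apply_apply hG hZ v).smul hZ).const_add (-v)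
    have h3 := h1.unique (h2.congr_of_eventuallyEq (h.mono fun y hy => hy.sq v))
    have h4 := DFunLike.congr_fun h3 u
    simp at h4
    rw [add_comm, h4]
    abel
  have d_skew : ∀ u v w, G y₀ v (F' u w) + G' u v (F y₀ w) =
      -(G y₀ w (F' u v) + G' u w (F y₀ v)) := fun u v w => by
    have h1 : (fun y => G y v (F y w)) =ᶠ[𝓝 y₀] fun y => -G y w (F y v) :=
      h.mono fun y hy => by
        change G y v (F y w) = -G y w (F y v)
        rw [← hy.skew, hy.symm]
    rw [← fderiv_apply_map hG hF, ← fderiv_apply_map hG hF, h1.fderiv_eq, fderiv_fun_neg]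
    rfl
  have d_map : ∀ u, F' u (Z y₀) + F y₀ (Z' u) = 0 := fun u => by
    have h1 := hF.clm_apply hZ
    have h3 := h1.unique ((hasFDerivAt_const (0 : E) y₀).congr_of_eventuallyEq
      (h.mono fun y hy => hy.map_ξ))
    have h4 := DFunLike.congr_fun h3 u
    simp at h4
    rw [add_comm, h4]
  have d_unit : ∀ u, 2 * G y₀ (Z y₀) (Z' u) + G' u (Z y₀) (Z y₀) = 0 := fun u => by
    have h1 := (hG.clm_apply hZ).clm_apply hZ
    have h3 := h1.unique ((hasFDerivAt_const (1 : ℝ) y₀).congr_of_eventuallyEq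
      (h.mono fun y hy => hy.unit))
    have h4 := DFunLike.congr_fun h3 u
    simp at h4
    rw [h0.symm (Z' u)] at h4
    linarith
  refine ⟨h0, ?_, fun u v => ?_, fun u v w => ?_, fun u => ?_, fun u => ?_, fun u v => ?_,
    fun u v w => ?_⟩
  · ext v
    simp [covEnd_apply, hΓ 0]
  · have h1 := d_sq u v
    rw [hG'] at h1
    rw [covVec_apply hΓ, covEnd_apply, covEnd_apply]
    simp only [map_add, map_sub, add_apply, h0.sq, map_neg, map_smul] at h1 ⊢
    linear_combination (norm := module) (1 : ℝ) • h1
  · have h1 := d_skew u v w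
    rw [hG', hG'] at h1
    simp only [covEnd_apply, map_add, map_sub, add_apply, sub_apply, h0.skew (Γ u v)]
    have h2 := h0.skew v (Γ u w)
    rw [h0.symm (F y₀ v)] at h2
    rw [h0.symm (F' u v), h0.symm (Γ u (F y₀ v))]
    linarith
  · rw [covVec_apply hΓ, covEnd_apply, h0.map_ξ, map_zero, add_zero,
      eq_neg_of_add_eq_zero_left (d_map u), map_add]
    abel
  · have h1 := d_unit u
    rw [hG', h0.symm (Γ u (Z y₀))] at h1
    rw [covVec_apply hΓ, map_add]
    linarith
  · rw [normal_covEnd hΓ, g_covVec hΓ hG']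
    exact hN u v
  · rw [g_covEnd hΓ hG' h0.skew h0.symm]
    exact hd u v w

end Jet

/-! ### Almost contact metric structures in a chart -/

section Structures

variable {E : Type*} [NormedAddCommGroup E] [NormedSpace ℝ E]
  {M : Type*} [TopologicalSpace M] [ChartedSpace E M] [IsManifold 𝓘(ℝ, E) ∞ M]
  {φ : EndField E M} {ξ : VField E M} {η : OneForm E M} {g : RMetric E M}

set_option synthInstance.maxHeartbeats 200000

theorem IsAlmostContactMetric.skew (h : IsAlmostContactMetric φ ξ η g) (x : M)
    (u v : TangentSpace 𝓘(ℝ, E) x) : g.inner x (φ x u) v = -g.inner x u (φ x v) := by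
  have h1 := h.inner_φ_self x (u + v)
  simp only [map_add, add_apply, h.inner_φ_self] at h1
  rw [g.symm x (φ x u)]
  linarith

theorem IsAlmostContactMetric.map_ξ (h : IsAlmostContactMetric φ ξ η g) (x : M) :
    φ x (ξ x) = 0 := by
  by_contra h0
  refine (g.pos x _ h0).ne' ?_
  have h1 := h.skew x (φ x (ξ x)) (ξ x)
  rw [h.φ_sq, h.η_ξ, one_smul, neg_add_cancel, map_zero, zero_apply] at h1
  linarith

theorem IsAlmostContactMetric.η_eq (h : IsAlmostContactMetric φ ξ η g) (x : M)
    (v : TangentSpace 𝓘(ℝ, E) x) : η x v = g.inner x (ξ x) v := by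
  have h1 := h.compatible x v (ξ x)
  rw [h.map_ξ, map_zero, h.η_ξ, mul_one] at h1
  rw [g.symm]
  linarith

/-- The value of an almost contact metric structure at a point. -/
theorem IsAlmostContactMetric.linear (h : IsAlmostContactMetric φ ξ η g) (x : M) :
    IsLinearContactMetric (E := E) (g.inner x) (φ x) (ξ x) where
  symm := g.symm x
  pos := g.pos x
  sq v := (h.φ_sq x v).trans (congrArg (fun c : ℝ => -v + c • (show E from ξ x)) (h.η_eq x v))
  map_ξ := h.map_ξ x
  skew := h.skew x
  unit := by
    have h1 := h.η_ξ x
    rwa [h.η_eq] at h1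

theorem chartD_chartEnd (φ : EndField E M) {x₀ : M} {y : E}
    (hy : y ∈ (extChartAt 𝓘(ℝ, E) x₀).target) (v : E) :
    chartD x₀ y (φ.chart x₀ y v) = φ ((extChartAt 𝓘(ℝ, E) x₀).symm y) (chartD x₀ y v) :=
  chartD_chartDInv hy _

theorem chartD_chartVec (ξ : VField E M) {x₀ : M} {y : E}
    (hy : y ∈ (extChartAt 𝓘(ℝ, E) x₀).target) :
    chartD x₀ y (ξ.chart x₀ y) = ξ ((extChartAt 𝓘(ℝ, E) x₀).symm y) :=
  chartD_chartDInv hy _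

theorem chartMetric_apply (g : RMetric E M) (x₀ : M) (y u v : E) :
    chartMetric g x₀ y u v =
      g.inner ((extChartAt 𝓘(ℝ, E) x₀).symm y) (chartD x₀ y u) (chartD x₀ y v) := rfl

theorem chartD_injective {x₀ : M} {y : E} (hy : y ∈ (extChartAt 𝓘(ℝ, E) x₀).target) :
    Function.Injective (chartD x₀ y) :=
  Function.LeftInverse.injective (chartDInv_chartD hy)

/-- An almost contact metric structure in a chart. -/
theorem IsAlmostContactMetric.chart (h : IsAlmostContactMetric φ ξ η g) {x₀ : M} {y : E}
    (hy : y ∈ (extChartAt 𝓘(ℝ, E) x₀).target) :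
    IsLinearContactMetric (chartMetric g x₀ y) (φ.chart x₀ y) (ξ.chart x₀ y) := by
  have hl := h.linear ((extChartAt 𝓘(ℝ, E) x₀).symm y)
  have hD := chartD_injective hy
  refine ⟨fun u v => ?_, fun v hv => ?_, fun v => ?_, ?_, fun u v => ?_, ?_⟩
  · rw [chartMetric_apply, chartMetric_apply]; exact hl.symm _ _
  · rw [chartMetric_apply]
    exact hl.pos _ ((map_ne_zero_iff _ hD).2 hv)
  · apply hD
    rw [chartD_chartEnd φ hy, chartD_chartEnd φ hy, map_add, map_neg, map_smul, chartMetric_apply,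
      chartD_chartVec ξ hy]
    exact hl.sq _
  · apply hD
    rw [chartD_chartEnd φ hy, chartD_chartVec ξ hy, map_zero]
    exact hl.map_ξ
  · rw [chartMetric_apply, chartMetric_apply, chartD_chartEnd φ hy, chartD_chartEnd φ hy]
    exact hl.skew _ _
  · rw [chartMetric_apply, chartD_chartVec ξ hy]
    exact hl.unit

theorem toDForm_inChart_apply (hη : ∀ x v, η x v = g.inner x (ξ x) v) {x₀ : M} {y : E}
    (hy : y ∈ (extChartAt 𝓘(ℝ, E) x₀).target) (v : Fin 1 → E) :
    η.toDForm.inChart x₀ y v = chartMetric g x₀ y (ξ.chart x₀ y) (v 0) := by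
  rw [chartMetric_apply, chartD_chartVec ξ hy]
  exact hη _ _

theorem fundamentalForm_inChart_apply (h : IsAlmostContactMetric φ ξ η g) {x₀ : M} {y : E}
    (hy : y ∈ (extChartAt 𝓘(ℝ, E) x₀).target) (v : Fin 2 → E) :
    h.fundamentalForm.inChart x₀ y v = chartMetric g x₀ y (v 0) (φ.chart x₀ y (v 1)) := by
  rw [chartMetric_apply, chartD_chartEnd φ hy]
  rfl

variable [FiniteDimensional ℝ E]

theorem toDForm_d_apply (hη : ∀ x v, η x v = g.inner x (ξ x) v) (hs : η.toDForm.IsSmooth)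
    (hξ : ξ.IsSmooth) (x₀ : M) (u v : E) :
    let y₀ := extChartAt 𝓘(ℝ, E) x₀ x₀
    let G' := fderiv ℝ (chartMetric g x₀) y₀
    let Z' := fderiv ℝ (ξ.chart x₀) y₀
    η.toDForm.d x₀ ![u, v] =
      (chartMetric g x₀ y₀ (Z' u) v + G' u (ξ.chart x₀ y₀) v) -
      (chartMetric g x₀ y₀ (Z' v) u + G' v (ξ.chart x₀ y₀) u) := by
  intro y₀ G' Z'
  have hG := (differentiableAt_chartMetric g x₀).hasFDerivAt
  have hZ := (hξ.differentiableAt_chart x₀).hasFDerivAt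
  have key : ∀ w : Fin 1 → E, (fun y => η.toDForm.inChart x₀ y w) =ᶠ[𝓝 y₀]
      fun y => chartMetric g x₀ y (ξ.chart x₀ y) (w 0) := fun w => by
    filter_upwards [target_mem_nhds x₀] with y hy
    exact toDForm_inChart_apply hη hy w
  refine (DForm.d_apply _ _ (![u, v] : Fin 2 → E)).trans ?_
  rw [extDeriv_apply (hs.differentiableAt_inChart x₀), Fin.sum_univ_two,
    (key _).fderiv_eq, (key _).fderiv_eq, fderiv_apply_apply hG hZ, fderiv_apply_apply hG hZ]
  simp [Fin.removeNth, Fin.succAbove, y₀, G', Z']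
  ring

theorem fundamentalForm_isSmooth (h : IsAlmostContactMetric φ ξ η g) :
    h.fundamentalForm.IsSmooth := by
  intro x₀
  let ι : (E →L[ℝ] ℝ) →L[ℝ] E [⋀^Fin 1]→L[ℝ] ℝ :=
    (ContinuousAlternatingMap.ofSubsingletonLIE (𝕜 := ℝ) (E := E) (F := ℝ)
      (0 : Fin 1)).toContinuousLinearEquiv.toContinuousLinearMap
  have hι : ∀ f (v : Fin 1 → E), ι f v = f (v 0) := fun f v => rfl
  let T : (E →L[ℝ] E [⋀^Fin 1]→L[ℝ] ℝ) →L[ℝ] E [⋀^Fin 2]→L[ℝ] ℝ :=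
    ContinuousAlternatingMap.alternatizeUncurryFinCLM ℝ E ℝ
  have hT : ∀ f (v : Fin 2 → E), T f v = f (v 0) ![v 1] - f (v 1) ![v 0] := fun f v => by
    refine (ContinuousAlternatingMap.alternatizeUncurryFin_apply f v).trans ?_
    rw [Fin.sum_univ_two]
    have h0 : Fin.removeNth 0 v = ![v 1] := by ext i; fin_cases i; rfl
    have h1 : Fin.removeNth 1 v = ![v 0] := by ext i; fin_cases i; rfl
    rw [h0, h1]
    simp [sub_eq_add_neg]
  -- Alternating the bilinear form `g(·, φ·)` doubles it, as it is already skew. This writes the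
  -- fundamental form as the image of smooth data under continuous linear maps and compositions.
  have hsmooth : ContDiffOn ℝ ∞ (fun y => (1 / 2 : ℝ) • T
        (ι ∘L ((ContinuousLinearMap.compL ℝ E E ℝ).flip (φ.chart x₀ y) ∘L chartMetric g x₀ y)))
      (extChartAt 𝓘(ℝ, E) x₀).target := by
    have hT' : ContDiff ℝ ∞ (fun f => T f) := by fun_prop
    have hb : ContDiffOn ℝ ∞ (fun y => ι ∘L
        ((ContinuousLinearMap.compL ℝ E E ℝ).flip (φ.chart x₀ y) ∘L chartMetric g x₀ y))
        (extChartAt 𝓘(ℝ, E) x₀).target := by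
      refine contDiffOn_const.clm_comp (ContDiffOn.clm_comp ?_ (contDiffOn_chartMetric g x₀))
      have hp : ContDiff ℝ ∞ (fun f => (ContinuousLinearMap.compL ℝ E E ℝ).flip f) := by fun_prop
      exact hp.comp_contDiffOn (EndField.contDiffOn_chart h.smooth_φ x₀)
    have hc := hT'.comp_contDiffOn hb
    exact hc.const_smul (1 / 2 : ℝ)
  refine hsmooth.congr fun y hy => ?_
  ext v
  have hl := h.chart hy
  have h1 := hl.skew (v 0) (v 1)
  rw [hl.symm] at h1
  rw [fundamentalForm_inChart_apply h hy]
  change _ = (1 / 2 : ℝ) * T _ v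
  rw [hT]
  change _ = (1 / 2 : ℝ) * (chartMetric g x₀ y (v 0) (φ.chart x₀ y (v 1)) -
    chartMetric g x₀ y (v 1) (φ.chart x₀ y (v 0)))
  rw [h1]
  ring

theorem fundamentalForm_d_apply (h : IsAlmostContactMetric φ ξ η g) (x₀ : M) (u v w : E) :
    let y₀ := extChartAt 𝓘(ℝ, E) x₀ x₀
    let G := chartMetric g x₀ y₀
    let G' := fderiv ℝ (chartMetric g x₀) y₀
    let F := φ.chart x₀ y₀
    let F' := fderiv ℝ (φ.chart x₀) y₀
    h.fundamentalForm.d x₀ ![u, v, w] =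
      (G v (F' u w) + G' u v (F w)) - (G u (F' v w) + G' v u (F w))
        + (G u (F' w v) + G' w u (F v)) := by
  intro y₀ G G' F F'
  have hG := (differentiableAt_chartMetric g x₀).hasFDerivAt
  have hF := (h.smooth_φ.differentiableAt_chart x₀).hasFDerivAt
  have key : ∀ w : Fin 2 → E, (fun y => h.fundamentalForm.inChart x₀ y w) =ᶠ[𝓝 y₀]
      fun y => chartMetric g x₀ y (w 0) (φ.chart x₀ y (w 1)) := fun w => by
    filter_upwards [target_mem_nhds x₀] with y hy
    exact fundamentalForm_inChart_apply h hy w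
  refine (DForm.d_apply _ _ (![u, v, w] : Fin 3 → E)).trans ?_
  rw [extDeriv_apply ((fundamentalForm_isSmooth h).differentiableAt_inChart x₀),
    Fin.sum_univ_three, (key _).fderiv_eq, (key _).fderiv_eq, (key _).fderiv_eq,
    fderiv_apply_map hG hF, fderiv_apply_map hG hF, fderiv_apply_map hG hF]
  simp [Fin.removeNth, Fin.succAbove, y₀, G, G', F, F']
  ring

/-- The Nijenhuis torsion is tensorial: all derivatives of `X` and `Y` cancel and only that of `φ`
is left. -/
theorem nijenhuis_apply (hφ : φ.IsSmooth) {X Y : VField E M} (hX : X.IsSmooth) (hY : Y.IsSmooth)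
    (x₀ : M) :
    let y₀ := extChartAt 𝓘(ℝ, E) x₀ x₀
    let F := φ.chart x₀ y₀
    let F' := fderiv ℝ (φ.chart x₀) y₀
    mlieBracket 𝓘(ℝ, E) (fun y => φ y (X y)) (fun y => φ y (Y y)) x₀
      - φ x₀ (mlieBracket 𝓘(ℝ, E) (fun y => φ y (X y)) Y x₀)
      - φ x₀ (mlieBracket 𝓘(ℝ, E) X (fun y => φ y (Y y)) x₀)
      + φ x₀ (φ x₀ (mlieBracket 𝓘(ℝ, E) X Y x₀)) =
    F' (F (X x₀)) (Y x₀) - F' (F (Y x₀)) (X x₀) + F (F' (Y x₀) (X x₀))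
      - F (F' (X x₀) (Y x₀)) := by
  intro y₀ F F'
  have hF := (hφ.differentiableAt_chart x₀).hasFDerivAt
  have hX' := (hX.differentiableAt_chart x₀).hasFDerivAt
  have hY' := (hY.differentiableAt_chart x₀).hasFDerivAt
  have key : ∀ X : VField E M, VField.chart (fun y => φ y (X y)) x₀ =ᶠ[𝓝 y₀]
      fun y => φ.chart x₀ y (X.chart x₀ y) := fun X => by
    filter_upwards [target_mem_nhds x₀] with y hy
    apply chartD_injective hy
    rw [chartD_chartEnd φ hy, chartD_chartVec _ hy, chartD_chartVec _ hy]
  have hφ0 : ∀ v : E, φ x₀ v = F v := fun v => (EndField.chart_self φ x₀ v).symm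
  have hb : ∀ V W : VField E M, mlieBracket 𝓘(ℝ, E) V W x₀ =
      lieBracket ℝ (V.chart x₀) (W.chart x₀) y₀ := fun V W => mlieBracket_eq V W x₀
  have e1 := (key X).lieBracket_vectorField_eq (𝕜 := ℝ) (key Y)
  have e2 := (key X).lieBracket_vectorField_eq (𝕜 := ℝ)
    (Filter.EventuallyEq.refl (𝓝 y₀) (Y.chart x₀))
  have e3 := (Filter.EventuallyEq.refl (𝓝 y₀) (X.chart x₀)).lieBracket_vectorField_eq
    (𝕜 := ℝ) (key Y)
  have d1 : fderiv ℝ (fun y => φ.chart x₀ y (X.chart x₀ y)) y₀ = _ := (hF.clm_apply hX').fderiv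
  have d2 : fderiv ℝ (fun y => φ.chart x₀ y (Y.chart x₀ y)) y₀ = _ := (hF.clm_apply hY').fderiv
  simp only [lieBracket_eq, d1, d2] at e1 e2 e3
  have hX0 : X.chart x₀ y₀ = X x₀ := VField.chart_self X x₀
  have hY0 : Y.chart x₀ y₀ = Y x₀ := VField.chart_self Y x₀
  let Φ : E →L[ℝ] E := φ x₀
  have hΦ : Φ = F := by ext v; exact hφ0 v
  let b₁ : E := mlieBracket 𝓘(ℝ, E) (fun y => φ y (X y)) (fun y => φ y (Y y)) x₀
  let b₂ : E := mlieBracket 𝓘(ℝ, E) (fun y => φ y (X y)) Y x₀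
  let b₃ : E := mlieBracket 𝓘(ℝ, E) X (fun y => φ y (Y y)) x₀
  let b₄ : E := mlieBracket 𝓘(ℝ, E) X Y x₀
  change b₁ - Φ b₂ - Φ b₃ + Φ (Φ b₄) = _
  rw [show b₁ = _ from (hb _ _).trans e1, show b₂ = _ from (hb _ _).trans e2,
    show b₃ = _ from (hb _ _).trans e3, show b₄ = _ from hb _ _, hΦ, ← hX0, ← hY0]
  simp only [lieBracket_eq, map_sub, map_add, add_apply, ContinuousLinearMap.comp_apply,
    ContinuousLinearMap.flip_apply]
  abel

end Structures

/-! ### The common operator at a point of a 3-quasi-Sasakian manifold -/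

section ThreeStructures

variable {E : Type*} [NormedAddCommGroup E] [NormedSpace ℝ E]
  {M : Type*} [TopologicalSpace M] [ChartedSpace E M] [IsManifold 𝓘(ℝ, E) ∞ M]
  {φ : Fin 3 → EndField E M} {ξ : Fin 3 → VField E M} {η : Fin 3 → OneForm E M} {g : RMetric E M}

set_option synthInstance.maxHeartbeats 200000

/-- The value of a 3-quasi-Sasakian structure at a point. -/
theorem IsThreeQuasiSasakian.linear (h : IsThreeQuasiSasakian φ ξ η g) (x : M) :
    IsLinearThreeStructure (E := E) (g.inner x) (fun α => φ α x) (fun α => ξ α x) where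
  contactMetric α := (h.quasiSasakian α).linear x
  φ_left α v := (h.φ_left α x v).trans (congrArg
    (fun c : ℝ => (show E from φ α x (φ (α + 1) x v)) - c • (show E from ξ α x))
    ((h.quasiSasakian (α + 1)).η_eq x v))
  φ_right α v := (h.φ_right α x v).trans (congrArg
    (fun c : ℝ => -(show E from φ (α + 1) x (φ α x v)) + c • (show E from ξ (α + 1) x))
    ((h.quasiSasakian α).η_eq x v))
  ξ_left α := h.ξ_left α x
  ξ_right α := h.ξ_right α x

/-- A 3-quasi-Sasakian structure in a chart. -/
theorem IsThreeQuasiSasakian.chart (h : IsThreeQuasiSasakian φ ξ η g) {x₀ : M} {y : E}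
    (hy : y ∈ (extChartAt 𝓘(ℝ, E) x₀).target) :
    IsLinearThreeStructure (chartMetric g x₀ y) (fun α => (φ α).chart x₀ y)
      (fun α => (ξ α).chart x₀ y) := by
  have hl := h.linear ((extChartAt 𝓘(ℝ, E) x₀).symm y)
  have hD := chartD_injective hy
  refine ⟨fun α => IsAlmostContactMetric.chart (h.quasiSasakian α).toIsAlmostContactMetric hy,
    fun α v => ?_, fun α v => ?_, fun α => ?_, fun α => ?_⟩
  · apply hD
    rw [map_sub, map_smul, chartD_chartEnd _ hy, chartD_chartEnd _ hy, chartD_chartEnd _ hy,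
      chartMetric_apply, chartD_chartVec _ hy, chartD_chartVec _ hy]
    exact hl.φ_left α _
  · apply hD
    rw [map_add, map_neg, map_smul, chartD_chartEnd _ hy, chartD_chartEnd _ hy,
      chartD_chartEnd _ hy, chartMetric_apply, chartD_chartVec _ hy, chartD_chartVec _ hy]
    exact hl.φ_right α _
  · apply hD
    rw [chartD_chartEnd _ hy, chartD_chartVec _ hy, chartD_chartVec _ hy]
    exact hl.ξ_left α
  · apply hD
    rw [map_neg, chartD_chartEnd _ hy, chartD_chartVec _ hy, chartD_chartVec _ hy]
    exact hl.ξ_right α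

theorem fderiv_chartMetric_symm [FiniteDimensional ℝ E] (g : RMetric E M) (x₀ : M) (u v w : E) :
    fderiv ℝ (chartMetric g x₀) (extChartAt 𝓘(ℝ, E) x₀ x₀) u v w =
      fderiv ℝ (chartMetric g x₀) (extChartAt 𝓘(ℝ, E) x₀ x₀) u w v := by
  have hG := (differentiableAt_chartMetric g x₀).hasFDerivAt
  have key : ∀ v w, fderiv ℝ (fun y => chartMetric g x₀ y v w) (extChartAt 𝓘(ℝ, E) x₀ x₀) u =
      fderiv ℝ (chartMetric g x₀) (extChartAt 𝓘(ℝ, E) x₀ x₀) u v w := fun v w => by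
    rw [fderiv_apply_apply hG (hasFDerivAt_const v _)]
    simp
  rw [← key, ← key]
  have : (fun y => chartMetric g x₀ y v w) = fun y => chartMetric g x₀ y w v := by
    funext y
    exact g.symm _ _ _
  rw [this]

/-- In a chart, the covariant derivatives at a point of a 3-quasi-Sasakian structure are given by one
symmetric operator commuting with the structure. -/
theorem IsThreeQuasiSasakian.exists_operator [FiniteDimensional ℝ E] [T2Space M]
    (h : IsThreeQuasiSasakian φ ξ η g) (x₀ : M) :
    let y₀ := extChartAt 𝓘(ℝ, E) x₀ x₀
    let G := chartMetric g x₀ y₀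
    let F := fun α => (φ α).chart x₀ y₀
    let Z := fun α => (ξ α).chart x₀ y₀
    ∃ (A : E →L[ℝ] E) (Γ : E → E →L[ℝ] E), IsCommutingSymm G F A ∧ (∀ u v, Γ u v = Γ v u) ∧
      (∀ α (u v : E), (η α).toDForm.d x₀ ![u, v] = G (F α (A u)) v - G (F α (A v)) u) ∧
      ∀ α u v, covEnd Γ (F α) (fderiv ℝ ((φ α).chart x₀) y₀) u v =
        G (Z α) v • A u - G (A u) v • Z α := by
  intro y₀ G F Z
  have h3 : IsLinearThreeStructure G F Z := h.chart (mem_extChartAt_target x₀)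
  obtain ⟨Γ, hΓ, hG'⟩ := exists_christoffel (h3.contactMetric 0).symm (h3.contactMetric 0).pos
    (fderiv_chartMetric_symm g x₀)
  have hG := (differentiableAt_chartMetric g x₀).hasFDerivAt
  have hq := h.quasiSasakian
  have hF := fun α => ((hq α).smooth_φ.differentiableAt_chart x₀).hasFDerivAt
  have hZ := fun α => ((hq α).smooth_ξ.differentiableAt_chart x₀).hasFDerivAt
  have hd := fun α u v => toDForm_d_apply (hq α).η_eq (hq α).smooth_η (hq α).smooth_ξ x₀ u v
  have hJ : ∀ α, IsQuasiSasakianJet G (F α) (Z α)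
      (covEnd Γ (F α) (fderiv ℝ ((φ α).chart x₀) y₀))
      (covVec Γ (Z α) (fderiv ℝ ((ξ α).chart x₀) y₀)) := fun α => by
    refine isQuasiSasakianJet hG (hF α) (hZ α) ?_ hΓ hG' (fun u v => ?_) fun u v w => ?_
    · filter_upwards [target_mem_nhds x₀] with y hy
      exact IsAlmostContactMetric.chart (hq α).toIsAlmostContactMetric hy
    -- Normality concerns globally smooth fields, so the two tangent vectors are extended first.
    · obtain ⟨X, hX, hXu⟩ := exists_smooth_vField x₀ u
      obtain ⟨Y, hY, hYv⟩ := exists_smooth_vField x₀ v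
      have h1 := (hq α).normal X Y hX hY x₀
      have h2 := nijenhuis_apply (hq α).smooth_φ hX hY x₀
      rw [h2] at h1
      have h4 := hd α (X x₀) (Y x₀)
      have h5 : (ξ α).chart x₀ y₀ = ξ α x₀ := VField.chart_self (ξ α) x₀
      rw [← hXu, ← hYv, ← h4, h5]
      exact h1
    · rw [← fundamentalForm_d_apply (hq α).toIsAlmostContactMetric x₀ u v w, (hq α).closed x₀]
      rfl
  -- The required relation between the derivatives is the Leibniz rule for `ξ (α + 2) = φ α (ξ (α +
  -- 1))`.
  obtain ⟨A, hA, hAB, hAP⟩ := h3.exists_commutingSymm hJ fun α u => by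
    have h1 := (hF α).clm_apply (hZ (α + 1))
    have h2 : (ξ (α + 2)).chart x₀ =ᶠ[𝓝 y₀]
        fun y => (φ α).chart x₀ y ((ξ (α + 1)).chart x₀ y) := by
      filter_upwards [target_mem_nhds x₀] with y hy
      exact (h.chart hy).ξ_left α
    have h4 := DFunLike.congr_fun ((hZ (α + 2)).unique (h1.congr_of_eventuallyEq h2)) u
    rw [covVec_apply hΓ, covVec_apply hΓ, covEnd_apply, h3.ξ_left α, h4]
    simp only [add_apply, ContinuousLinearMap.comp_apply, ContinuousLinearMap.flip_apply, map_add,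
      F, Z, y₀]
    abel
  refine ⟨A, Γ, hA, hΓ, fun α u v => ?_, hAP⟩
  rw [← hAB, ← hAB, g_covVec hΓ hG']
  exact hd α u v

end ThreeStructures

/-! ### Linear combinations of tensor fields -/

section Combinations

variable {E : Type*} [NormedAddCommGroup E] [NormedSpace ℝ E]
  {M : Type*} [TopologicalSpace M] [ChartedSpace E M]
  {N : ℕ} (lam : EuclideanSpace ℝ (Fin N))

set_option synthInstance.maxHeartbeats 200000

theorem combo_toDForm (η : Fin N → OneForm E M) :
    OneForm.toDForm (combo lam η) = combo lam fun α => (η α).toDForm := by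
  funext x
  ext v
  change (∑ α, lam α • η α x) (v 0) = (∑ α, lam α • (η α).toDForm x) v
  rw [_root_.sum_apply, ContinuousAlternatingMap.sum_apply]
  rfl

theorem combo_inChart {k : ℕ} (θ : Fin N → DForm E M k) (x₀ : M) :
    DForm.inChart (combo lam θ) x₀ = fun y => ∑ α, lam α • (θ α).inChart x₀ y := by
  funext y
  ext v
  rw [ContinuousAlternatingMap.sum_apply]
  refine (ContinuousAlternatingMap.sum_apply _ _).trans ?_
  rfl

theorem combo_smooth_dForm {k : ℕ} {θ : Fin N → DForm E M k} (hθ : ∀ α, (θ α).IsSmooth) :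
    DForm.IsSmooth (combo lam θ) := fun x₀ => by
  rw [combo_inChart]
  exact ContDiffOn.sum fun α _ => (hθ α x₀).const_smul (lam α)

variable [IsManifold 𝓘(ℝ, E) ∞ M]

theorem combo_d_apply {k : ℕ} {θ : Fin N → DForm E M k} (hθ : ∀ α, (θ α).IsSmooth) (x₀ : M)
    (v : Fin (k + 1) → E) :
    DForm.d (combo lam θ) x₀ v = ∑ α, lam α * (θ α).d x₀ v := by
  have hd : HasFDerivAt (fun y => ∑ α, lam α • (θ α).inChart x₀ y)
      (∑ α, lam α • fderiv ℝ ((θ α).inChart x₀) (extChartAt 𝓘(ℝ, E) x₀ x₀))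
      (extChartAt 𝓘(ℝ, E) x₀ x₀) := HasFDerivAt.fun_sum fun α _ =>
    ((hθ α).differentiableAt_inChart x₀).hasFDerivAt.const_smul (lam α)
  rw [DForm.d_apply, combo_inChart, extDeriv, hd.fderiv,
    ← ContinuousAlternatingMap.alternatizeUncurryFinCLM_apply, map_sum,
    ContinuousAlternatingMap.sum_apply]
  refine Finset.sum_congr rfl fun α _ => ?_
  rw [map_smul, DForm.d_apply]
  rfl

theorem combo_smooth_vField {ξ : Fin N → VField E M} (hξ : ∀ α, (ξ α).IsSmooth) :
    VField.IsSmooth (combo lam ξ) :=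
  ContMDiff.sum_section fun α _ => (hξ α).const_smul_section (a := lam α)

theorem combo_smooth_endField {φ : Fin N → EndField E M} (hφ : ∀ α, (φ α).IsSmooth) :
    EndField.IsSmooth (combo lam φ) :=
  ContMDiff.sum_section fun α _ => (hφ α).const_smul_section (a := lam α)

omit [IsManifold 𝓘(ℝ, E) ∞ M] in
theorem combo_endField_chart (φ : Fin N → EndField E M) (x₀ : M) :
    EndField.chart (combo lam φ) x₀ = fun y => ∑ α, lam α • (φ α).chart x₀ y := by
  funext y
  ext v
  rw [_root_.sum_apply]
  change chartDInv x₀ y ((show E →L[ℝ] E from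
    ∑ α, lam α • (show E →L[ℝ] E from φ α ((extChartAt 𝓘(ℝ, E) x₀).symm y))) (chartD x₀ y v)) = _
  rw [_root_.sum_apply, map_sum]
  refine Finset.sum_congr rfl fun α _ => ?_
  rw [smul_apply, map_smul]
  rfl

omit [IsManifold 𝓘(ℝ, E) ∞ M] in
theorem combo_vField_chart (ξ : Fin N → VField E M) (x₀ : M) :
    VField.chart (combo lam ξ) x₀ = fun y => ∑ α, lam α • (ξ α).chart x₀ y := by
  funext y
  refine (map_sum (chartDInv x₀ y) _ _).trans ?_
  refine Finset.sum_congr rfl fun α _ => ?_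
  exact map_smul (chartDInv x₀ y) _ _

theorem combo_η_eq {g : RMetric E M} {ξ : Fin N → VField E M} {η : Fin N → OneForm E M}
    (hη : ∀ α x v, η α x v = g.inner x (ξ α x) v) (x : M) (v : TangentSpace 𝓘(ℝ, E) x) :
    combo lam η x v = g.inner x (combo lam ξ x) v := by
  simp only [combo, map_sum, _root_.sum_apply, map_smul, smul_apply, hη]

theorem fderiv_combo_endField_chart [FiniteDimensional ℝ E] {φ : Fin N → EndField E M}
    (hφ : ∀ α, (φ α).IsSmooth) (x₀ : M) :
    fderiv ℝ (EndField.chart (combo lam φ) x₀) (extChartAt 𝓘(ℝ, E) x₀ x₀) =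
      ∑ α, lam α • fderiv ℝ ((φ α).chart x₀) (extChartAt 𝓘(ℝ, E) x₀ x₀) := by
  rw [combo_endField_chart]
  exact (HasFDerivAt.fun_sum fun α _ =>
    ((hφ α).differentiableAt_chart x₀).hasFDerivAt.const_smul (lam α)).fderiv

end Combinations

/-! ### Quasi-Sasakian structures parametrized by the sphere -/

section Sphere

variable {E : Type*} [NormedAddCommGroup E] [NormedSpace ℝ E]
  {M : Type*} [TopologicalSpace M] [ChartedSpace E M] [IsManifold 𝓘(ℝ, E) ∞ M]
  {φ : Fin 3 → EndField E M} {ξ : Fin 3 → VField E M} {η : Fin 3 → OneForm E M} {g : RMetric E M}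
  {lam : EuclideanSpace ℝ (Fin 3)}

set_option synthInstance.maxHeartbeats 200000

theorem sum_sq_of_mem_sphere (hlam : lam ∈ Metric.sphere (0 : EuclideanSpace ℝ (Fin 3)) 1) :
    ∑ α, lam α ^ 2 = 1 := by
  have h1 : ‖lam‖ = 1 := by simpa using hlam
  rw [← EuclideanSpace.real_norm_sq_eq, h1, one_pow]

theorem IsThreeQuasiSasakian.combo_almostContactMetric (h : IsThreeQuasiSasakian φ ξ η g)
    (hlam : ∑ α, lam α ^ 2 = 1) :
    IsAlmostContactMetric (combo lam φ) (combo lam ξ) (combo lam η) g := by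
  have hη : ∀ x v, combo lam η x v = g.inner x (combo lam ξ x) v :=
    combo_η_eq lam fun α => (h.quasiSasakian α).η_eq
  have hl : ∀ x, IsLinearContactMetric (E := E) (g.inner x) (combo lam φ x) (combo lam ξ x) :=
    fun x => (h.linear x).combo hlam
  refine ⟨⟨combo_smooth_endField lam fun α => (h.quasiSasakian α).smooth_φ,
    combo_smooth_vField lam fun α => (h.quasiSasakian α).smooth_ξ, ?_, fun x v => ?_, fun x => ?_⟩,
    fun x v w => ?_⟩
  · rw [combo_toDForm]
    exact combo_smooth_dForm lam fun α => (h.quasiSasakian α).smooth_η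
  · rw [hη]
    exact (hl x).sq v
  · rw [hη]
    exact (hl x).unit
  · rw [hη, hη]
    exact (hl x).compatible v w

theorem IsThreeQuasiSasakian.fundamentalForm_combo (h : IsThreeQuasiSasakian φ ξ η g)
    (hc : IsAlmostContactMetric (combo lam φ) (combo lam ξ) (combo lam η) g) :
    hc.fundamentalForm = combo lam h.Ω := by
  funext x
  ext v
  refine Eq.trans ?_ (ContinuousAlternatingMap.sum_apply _ _).symm
  change g.inner x (v 0) ((∑ α, lam α • φ α x) (v 1)) =
    ∑ α, lam α * g.inner x (v 0) (φ α x (v 1))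
  rw [_root_.sum_apply, map_sum]
  simp only [smul_apply, map_smul, smul_eq_mul]

theorem IsThreeQuasiSasakian.combo_d_η (h : IsThreeQuasiSasakian φ ξ η g) (x₀ : M)
    {G : E →L[ℝ] E →L[ℝ] ℝ} {F : Fin 3 → E →L[ℝ] E} {A : E →L[ℝ] E}
    (hd : ∀ α (u v : E), (η α).toDForm.d x₀ ![u, v] = G (F α (A u)) v - G (F α (A v)) u)
    (u v : E) :
    (OneForm.toDForm (combo lam η)).d x₀ ![u, v] =
      G ((∑ α, lam α • F α) (A u)) v - G ((∑ α, lam α • F α) (A v)) u := by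
  rw [combo_toDForm]
  refine (combo_d_apply lam (fun α => (h.quasiSasakian α).smooth_η) x₀ (![u, v] : Fin 2 → E)).trans
    ?_
  simp only [_root_.sum_apply, map_sum, smul_apply, map_smul, smul_eq_mul, ← Finset.sum_sub_distrib,
    ← mul_sub]
  exact Finset.sum_congr rfl fun α _ => congrArg _ (hd α u v)

variable [FiniteDimensional ℝ E]

theorem IsThreeQuasiSasakian.combo_closed (h : IsThreeQuasiSasakian φ ξ η g) :
    DForm.IsClosed (combo lam h.Ω) := fun x => by
  ext v
  refine (combo_d_apply lam (fun α => fundamentalForm_isSmooth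
    (h.quasiSasakian α).toIsAlmostContactMetric) x v).trans ?_
  refine Finset.sum_eq_zero fun α _ => ?_
  have h1 : (h.Ω α).d x = 0 := (h.quasiSasakian α).closed x
  exact mul_eq_zero_of_right _ (DFunLike.congr_fun h1 v)

theorem IsThreeQuasiSasakian.combo_normal [T2Space M] (h : IsThreeQuasiSasakian φ ξ η g)
    (hlam : ∑ α, lam α ^ 2 = 1) :
    IsNormal (combo lam φ) (combo lam ξ) (combo lam η) := by
  intro X Y hX hY x₀
  have h3 := h.chart (mem_extChartAt_target (I := 𝓘(ℝ, E)) x₀)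
  obtain ⟨A, Γ, hA, hΓ, hd, hP⟩ := h.exists_operator x₀
  let y₀ := extChartAt 𝓘(ℝ, E) x₀ x₀
  let G := chartMetric g x₀ y₀
  let F := fun α => (φ α).chart x₀ y₀
  let F' := fun α => fderiv ℝ ((φ α).chart x₀) y₀
  let Z := fun α => (ξ α).chart x₀ y₀
  let ψ : E →L[ℝ] E := ∑ α, lam α • F α
  let ζ : E := ∑ α, lam α • Z α
  have hl : IsLinearContactMetric G ψ ζ := h3.combo hlam
  have hφ := fun α => (h.quasiSasakian α).smooth_φ
  have hψ : EndField.chart (combo lam φ) x₀ y₀ = ψ :=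
    congrFun (combo_endField_chart lam φ x₀) y₀
  have hζ : combo lam ξ x₀ = ζ :=
    (VField.chart_self (combo lam ξ) x₀).symm.trans (congrFun (combo_vField_chart lam ξ x₀) y₀)
  -- The same `A` and `Γ` serve all three structures, so the formula for ∇φ_α can be summed.
  have hcov : ∀ u v, covEnd Γ ψ (∑ α, lam α • F' α) u v = G ζ v • A u - G (A u) v • ζ :=
    fun u v => by
    have h1 : covEnd Γ ψ (∑ α, lam α • F' α) u v =
        ∑ α, lam α • covEnd Γ (F α) (F' α) u v := by
      simp only [covEnd_apply, ψ, _root_.sum_apply, smul_apply, map_sum, map_smul, smul_add,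
        smul_sub, Finset.sum_add_distrib, Finset.sum_sub_distrib]
    have h2 : ∀ α, covEnd Γ (F α) (F' α) u v = G (Z α) v • A u - G (A u) v • Z α :=
      fun α => hP α u v
    simp only [h1, h2, ζ, map_sum, map_smul, _root_.sum_apply, smul_apply, smul_sub,
      Finset.sum_sub_distrib, Finset.sum_smul, Finset.smul_sum, smul_smul, smul_eq_mul]
    simp only [mul_comm]
  have hc : ∀ u, ψ (A u) = A (ψ u) := fun u => by
    simp only [ψ, _root_.sum_apply, smul_apply, map_sum, map_smul]
    exact Finset.sum_congr rfl fun α _ => congrArg _ (hA.comm α u)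
  have hN : ∀ u v : E, (∑ α, lam α • F' α) (ψ u) v - (∑ α, lam α • F' α) (ψ v) u
      + ψ ((∑ α, lam α • F' α) v u) - ψ ((∑ α, lam α • F' α) u v)
      + (G (ψ (A u)) v - G (ψ (A v)) u) • ζ = 0 := fun u v => by
    rw [← normal_covEnd hΓ]
    exact hl.normal_of_operator hc hcov u v
  rw [nijenhuis_apply (combo_smooth_endField lam hφ) hX hY x₀, hψ,
    fderiv_combo_endField_chart lam hφ x₀]
  have h2 : (OneForm.toDForm (combo lam η)).d x₀ ![X x₀, Y x₀] = _ :=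
    h.combo_d_η (lam := lam) x₀ hd (X x₀) (Y x₀)
  rw [h2, hζ]
  exact hN (X x₀) (Y x₀)

end Sphere

/-! ### Rank, characteristic spaces and the almost cosymplectic condition -/

section Rank

variable {E : Type*} [NormedAddCommGroup E] [NormedSpace ℝ E] [FiniteDimensional ℝ E]
  {M : Type*} [TopologicalSpace M] [ChartedSpace E M] [IsManifold 𝓘(ℝ, E) ∞ M]
  {φ : Fin 3 → EndField E M} {ξ : Fin 3 → VField E M} {η : Fin 3 → OneForm E M} {g : RMetric E M}

set_option synthInstance.maxHeartbeats 200000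

/-- The characteristic spaces of the forms of a 3-quasi-Sasakian structure of rank `4 * l + 3`, and
of their unit combinations, are all the kernel of one operator. -/
theorem IsThreeQuasiSasakianOfRank.exists_mem_charDist_iff [T2Space M] {l : ℕ}
    (h : IsThreeQuasiSasakianOfRank φ ξ η g (4 * l + 3)) (x₀ : M) :
    ∃ A : E →L[ℝ] E, (∀ α (v : E), v ∈ charDist (η α) x₀ ↔ A v = 0) ∧
      ∀ lam : EuclideanSpace ℝ (Fin 3), ∑ α, lam α ^ 2 = 1 →
        ∀ v : E, v ∈ charDist (combo lam η) x₀ ↔ A v = 0 := by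
  have h3 := h.chart (mem_extChartAt_target (I := 𝓘(ℝ, E)) x₀)
  obtain ⟨A, Γ, hA, -, hd, -⟩ := h.exists_operator x₀
  obtain ⟨a, ha⟩ := h3.exists_eigenvalue hA
  let y₀ := extChartAt 𝓘(ℝ, E) x₀ x₀
  let G := chartMetric g x₀ y₀
  let F := fun α => (φ α).chart x₀ y₀
  let Z := fun α => (ξ α).chart x₀ y₀
  have hη : ∀ α (v : E), η α x₀ v = G (Z α) v := fun α v => by
    have h1 : Z α = ξ α x₀ := VField.chart_self (ξ α) x₀
    rw [h1]
    exact ((h.quasiSasakian α).η_eq x₀ v).trans (chartMetric_self g x₀ _ v).symm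
  have key : ∀ α (v : E), v ∈ charDist (η α) x₀ ↔ G (Z α) v = 0 ∧ A v = 0 := fun α v => by
    rw [← (h3.contactMetric α).charSpace_iff hA.symm (hA.comm α) (ha α) v]
    refine and_congr (by rw [hη]) (forall_congr' fun w => ?_)
    exact Eq.congr_left (hd α v w)
  -- The residue of the rank modulo 4 enters here.
  have ha0 : a ≠ 0 := h3.eigenvalue_ne_zero (α := 0) (K := charDist (η 0) x₀) hA ha (key 0)
    (h.rank 0 x₀)
  refine ⟨A, fun α v => ?_, fun lam hlam v => ?_⟩
  · rw [key]
    exact and_iff_right_of_imp fun hv => eq_zero_of_map_eq_zero_of_symm hA.symm (ha α) ha0 hv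
  · have hc : ∀ u, (∑ α, lam α • F α) (A u) = A ((∑ α, lam α • F α) u) := fun u => by
      simp only [_root_.sum_apply, smul_apply, map_sum, map_smul]
      exact Finset.sum_congr rfl fun α _ => congrArg _ (hA.comm α u)
    have hAζ : A (∑ α, lam α • Z α) = a • ∑ α, lam α • Z α := by
      rw [map_sum, Finset.smul_sum]
      refine Finset.sum_congr rfl fun α _ => ?_
      rw [map_smul, smul_comm a]
      exact congrArg _ (ha α)
    have hηv : combo lam η x₀ v = G (∑ α, lam α • Z α) v := by
      refine (_root_.sum_apply _ _ _).trans ?_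
      simp only [_root_.sum_apply, smul_apply, map_sum, map_smul]
      exact Finset.sum_congr rfl fun α _ => congrArg (lam α * ·) (hη α v)
    have h1 : v ∈ charDist (combo lam η) x₀ ↔ G (∑ α, lam α • Z α) v = 0 ∧ A v = 0 := by
      rw [← (h3.combo hlam).charSpace_iff hA.symm hc hAζ v]
      refine and_congr (Eq.congr_left hηv) (forall_congr' fun w => ?_)
      exact Eq.congr_left (h.combo_d_η x₀ hd v w)
    rw [h1]
    exact and_iff_right_of_imp fun hv => eq_zero_of_map_eq_zero_of_symm hA.symm hAζ ha0 hv

theorem IsThreeQuasiSasakianOfRank.charDist_combo [T2Space M] {l : ℕ}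
    (h : IsThreeQuasiSasakianOfRank φ ξ η g (4 * l + 3)) {lam : EuclideanSpace ℝ (Fin 3)}
    (hlam : ∑ α, lam α ^ 2 = 1) (x : M) :
    charDist (combo lam η) x = commonCharDist η x ∧ charDist (combo lam η) x = charDist (η 0) x := by
  obtain ⟨A, hA, hAl⟩ := h.exists_mem_charDist_iff x
  refine ⟨Submodule.ext fun v => ?_, Submodule.ext fun v => (hAl lam hlam v).trans (hA 0 v).symm⟩
  rw [commonCharDist, Submodule.mem_iInf]
  exact (hAl lam hlam v).trans ⟨fun hv α => (hA α v).2 hv, fun hv => (hA 0 v).1 (hv 0)⟩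

theorem IsThreeQuasiSasakianOfRank.hasRank_combo [T2Space M] {l : ℕ}
    (h : IsThreeQuasiSasakianOfRank φ ξ η g (4 * l + 3)) {lam : EuclideanSpace ℝ (Fin 3)}
    (hlam : ∑ α, lam α ^ 2 = 1) : HasRank (combo lam η) (4 * l + 3) := fun x => by
  rw [cartanClass, (h.charDist_combo hlam x).2]
  exact h.rank 0 x

theorem IsThreeQuasiSasakian.combo_quasiSasakian [T2Space M] (h : IsThreeQuasiSasakian φ ξ η g)
    {lam : EuclideanSpace ℝ (Fin 3)} (hlam : ∑ α, lam α ^ 2 = 1) :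
    IsQuasiSasakian (combo lam φ) (combo lam ξ) (combo lam η) g := by
  have hc := h.combo_almostContactMetric hlam
  refine ⟨hc, h.combo_normal hlam, ?_⟩
  rw [h.fundamentalForm_combo hc]
  exact h.combo_closed

theorem IsThreeQuasiSasakian.exists_finrank_eq [Nonempty M] (h : IsThreeQuasiSasakian φ ξ η g) :
    ∃ n, Module.finrank ℝ E = 2 * n + 1 := by
  obtain ⟨x⟩ := ‹Nonempty M›
  obtain ⟨m, hm⟩ := (h.linear x).finrank_eq
  exact ⟨2 * m + 1, by omega⟩

theorem IsAlmostContactMetric.isAlmostCosymplectic {φ : EndField E M} {ξ : VField E M}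
    {η : OneForm E M} (h : IsAlmostContactMetric φ ξ η g)
    (hn : ∃ n, Module.finrank ℝ E = 2 * n + 1) : IsAlmostCosymplectic η h.fundamentalForm := by
  obtain ⟨n, hn⟩ := hn
  refine ⟨h.smooth_η, fundamentalForm_isSmooth h, n, hn, fun x => ?_⟩
  exact (h.linear x).wedge_ne_zero hn _ _ (h.η_eq x) (h.fundamentalForm_apply x)

end Rank

end QuasiContact

end

theorem mainTheorem7 {E : Type*} [NormedAddCommGroup E] [NormedSpace ℝ E] [FiniteDimensional ℝ E]
    {M : Type*} [TopologicalSpace M] [T2Space M] [SecondCountableTopology M] [Nonempty M]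
    [ChartedSpace E M] [IsManifold 𝓘(ℝ, E) ∞ M]
    (φ : Fin 3 → QuasiContact.EndField E M) (ξ : Fin 3 → QuasiContact.VField E M)
    (η : Fin 3 → QuasiContact.OneForm E M) (g : QuasiContact.RMetric E M) (l : ℕ)
    (h : QuasiContact.IsThreeQuasiSasakianOfRank φ ξ η g (4 * l + 3)) :
    (∀ lam ∈ Metric.sphere (0 : EuclideanSpace ℝ (Fin 3)) 1,
      QuasiContact.IsQuasiSasakian (QuasiContact.combo lam φ) (QuasiContact.combo lam ξ)
          (QuasiContact.combo lam η) g ∧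
        QuasiContact.HasRank (QuasiContact.combo lam η) (4 * l + 3) ∧
        ∀ x : M, QuasiContact.charDist (QuasiContact.combo lam η) x =
          QuasiContact.commonCharDist η x) ∧
    QuasiContact.IsQuasiContactSphere (p := 2) η h.Ω (4 * l + 3) := by
  have hs := fun (lam : EuclideanSpace ℝ (Fin 3)) (hlam : lam ∈ Metric.sphere 0 1) =>
    QuasiContact.sum_sq_of_mem_sphere hlam
  refine ⟨fun lam hlam => ⟨h.combo_quasiSasakian (hs lam hlam), h.hasRank_combo (hs lam hlam),
    fun x => (h.charDist_combo (hs lam hlam) x).1⟩, ⟨fun α => ?_, fun lam hlam => ?_⟩,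
    fun lam _ => h.combo_closed, by omega, fun lam hlam => h.hasRank_combo (hs lam hlam)⟩
  · exact (h.quasiSasakian α).isAlmostCosymplectic h.exists_finrank_eq
  -- Ω_λ is the fundamental form of φ_λ, so the volume argument used for the generators applies to
  -- it.
  · have hc := h.combo_almostContactMetric (hs lam hlam)
    rw [← h.fundamentalForm_combo hc]
    exact hc.isAlmostCosymplectic h.exists_finrank_eq
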